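/- For each $k\ge 1$ consider a pure exploration problem with $k$ alternatives. Alternative $i$ of the $k$-th problem has a distribution (that of $X_i$) with mean $\mu_i$ and variance $\sigma_i^2$; these distributions may depend on $k$, except that the distribution of alternative $1$ does not. The observations $X_{i,1},X_{i,2},\dots$ of alternative $i$ are i.i.d. copies of $X_i$, and different alternatives are sampled independently. Let $f:\{1,2,\dots\}\to[0,\infty)$ satisfy $\lim_{n\to\infty}f(n)=0$, and let $U_i(n)=\frac1n\sum_{j=1}^nX_{i,j}+f(n)$. The meta-UCB algorithm with total budget $B$ takes one observation of each alternative; then, while the total number of observations is less than $B$, it takes one more observation from an alternative $i$ that maximizes $U_i(n_i)$, where $n_i$ is the current sample size of alternative $i$; finally it outputs an alternative with the largest sample size. Ties are broken arbitrarily. Let $\mathrm{PCS}$ be the probability that the output is alternative $1$, and let $U_1^*=\inf_{n\ge1}U_1(n)$. Assume: (1) every $X_i$ has a continuous distribution, and there are $q>3$ and $M>0$ with $\mathrm E|X_i|^q\le M$ for all $i\le k$ and all $k$; (2) there are $\gamma,\underline\sigma^2,\bar\sigma^2>0$ such that $\mu_1-\mu_i\ge\gamma$ for $2\le i\le k$ and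 $\underline\sigma^2\le\sigma_i^2\le\bar\sigma^2$ for $1\le i\le k$, for all $k$. For $b>0$ let $n^f(b)$ be a positive integer such that $f(n)<b$ for all $n\ge n^f(b)$, where the choice is constant on some interval $(\gamma/2-\varepsilon,\gamma/2]$ (as it is when $n^f(b)$ is the least such integer). Let $$C(b;n)=c_1b^{-q}n^{-q+2}+\frac{e^{-nc_2b^2}}{1-e^{-c_2b^2}}+n,\qquad c_1=\Big(2+\frac4q\Big)^qM\,\frac{q-1}{q-2},\qquad c_2=\frac{M^{-2/q}}{2(q+2)^{2}e^{q}} .$$ Let $c>2C(\gamma/2;n^f(\gamma/2))$ and let the total budget be $B=ck$ (rounded up or down to an integer). Then the supremum $$\gamma_0=\sup\{g\in(0,\gamma):\ 2C((\gamma-g)/2;\,n^f((\gamma-g)/2))\le c\}$$ is over a nonempty set, and $$\liminf_{k\to\infty}\mathrm{PCS}\ \ge\ \Pr\{U_1^*\ge\mu_1-\gamma_0\}\ >\ 0 .$$ In particular the meta-UCB algorithm is sample optimal: there is $\alpha\in(0,1)$ with $\liminf_{k\to\infty}\mathrm{PCS}>\alpha$ for $B=ck$. -/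

import Mathlib

open MeasureTheory ProbabilityTheory Filter Topology

noncomputable section

/-- The sample mean of the first `n` observations `x 0, …, x (n - 1)` of an alternative. -/
def sampleMean (x : ℕ → ℝ) (n : ℕ) : ℝ := (∑ j ∈ Finset.range n, x j) / n

/-- The UCB value after `n ≥ 1` observations, with exploration bonus function `f`. -/
def ucb (f : ℕ → ℝ) (x : ℕ → ℝ) (n : ℕ) : ℝ := sampleMean x n + f n

/-- The minimum `U^* = inf_{n ≥ 1} U(n)` of a UCB value process, as an extended real. -/
def ucbInf (f : ℕ → ℝ) (x : ℕ → ℝ) : EReal := ⨅ n : ℕ, ⨅ _ : 1 ≤ n, (ucb f x n : EReal)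

/-- The exploration bonus function is nonnegative and vanishes as the sample size grows. -/
structure IsBonus (f : ℕ → ℝ) : Prop where
  nonneg : ∀ n, 1 ≤ n → 0 ≤ f n
  tendsto_zero : Tendsto f atTop (𝓝 0)

/-- Sample-size vectors that the meta-UCB loop can be at, on the observations `x i j` (`x i j` is
what the `(j+1)`-st sampling of alternative `i` returns), under a total budget `B`. First every
alternative is sampled once; then, as long as the total sample size is below `B`, an alternative
with the largest UCB value is sampled once more. Ties may be broken in any way. -/
inductive MetaUCBReachable {ι : Type*} [Fintype ι] [DecidableEq ι]
    (f : ℕ → ℝ) (x : ι → ℕ → ℝ) (B : ℕ) : (ι → ℕ) → Prop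
  | init : MetaUCBReachable f x B (fun _ => 1)
  | step (n : ι → ℕ) (s : ι) (hn : MetaUCBReachable f x B n) (hB : ∑ i, n i < B)
      (hs : ∀ i, ucb f (x i) (n i) ≤ ucb f (x s) (n s)) :
      MetaUCBReachable f x B (Function.update n s (n s + 1))

/-- The meta-UCB algorithm may output alternative `b`: the loop has ended, and `b` has the largest
sample size. Ties may be broken in any way. -/
def MetaUCBOutputs {ι : Type*} [Fintype ι] [DecidableEq ι]
    (f : ℕ → ℝ) (x : ι → ℕ → ℝ) (B : ℕ) (b : ι) : Prop :=
  ∃ n : ι → ℕ, MetaUCBReachable f x B n ∧ B ≤ ∑ i, n i ∧ ∀ i, n i ≤ n b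

/-- The observations `X i j`, `j = 0, 1, …`, of alternative `i` are i.i.d. with distribution `ν i`,
and different alternatives are sampled independently. -/
structure IsSampling {ι Ω : Type*} [MeasurableSpace Ω] (P : Measure Ω)
    (ν : ι → Measure ℝ) (X : ι → ℕ → Ω → ℝ) : Prop where
  hasLaw : ∀ i j, HasLaw (X i j) (ν i) P
  indep : iIndepFun (fun p : ι × ℕ => X p.1 p.2) P

def momentA₁ (q M : ℝ) : ℝ := (2 + 4 / q) ^ q * M

def momentA₂ (q M : ℝ) : ℝ := (q + 2) ^ (-2 : ℝ) * Real.exp (-q) * M ^ (-2 / q) / 2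

def momentC₁ (q M : ℝ) : ℝ := momentA₁ q M * ((q - 1) / (q - 2))

def momentC₂ (q M : ℝ) : ℝ := momentA₂ q M

/-- `C(b; n) = c₁ b^{-q} n^{-q+2} + exp(-n c₂ b²) / (1 - exp(-c₂ b²)) + n`. -/
def momentC (q M b : ℝ) (n : ℕ) : ℝ :=
  momentC₁ q M * b ^ (-q) * (n : ℝ) ^ (-q + 2)
    + Real.exp (-(n * momentC₂ q M * b ^ 2)) / (1 - Real.exp (-(momentC₂ q M * b ^ 2))) + n

/-- `N` is a positive integer such that `f n < b` for all `n ≥ N`. -/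
def IsThreshold (f : ℕ → ℝ) (b : ℝ) (N : ℕ) : Prop := 1 ≤ N ∧ ∀ n, N ≤ n → f n < b

/-- The `g ∈ (0, γ)` with `2 C((γ - g)/2; n^f((γ - g)/2)) ≤ c`, for a choice `nf` of `n^f`. -/
def admissibleSet (q M γ c : ℝ) (nf : ℝ → ℕ) : Set ℝ :=
  {g | g ∈ Set.Ioo 0 γ ∧ 2 * momentC q M ((γ - g) / 2) (nf ((γ - g) / 2)) ≤ c}

end

/-! Fix an admissible `g` and put `a = μ₁ - g`, `b = (γ - g)/2`, `N = n^f(b)`. On the event `U₁* ≥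
a` an inferior alternative can be resampled only while its own UCB value is at least `a`. Its final
sample size is therefore at most its run length: the number of sizes `n < B`, counting `n = 0`, up
to which its UCB value has stayed at or above `a`. The run length depends on the observations of
that alternative alone, so the adaptivity of the algorithm disappears and the run lengths are
independent.

Since the mean of an inferior alternative is at most `a - 2b` and `f n < b` for `n ≥ N`, a run
reaching `n ≥ N` forces the sample mean to exceed its expectation by `b`. A one-sided Fuk–Nagaev
inequality (`measureReal_sum_ge_le_fukNagaev`) bounds this probability. Summing over `n` gives an
expected run length strictly below `C(b; N) ≤ c/2` (`integral_runLength_le`,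
`sizeBound_lt_momentC`), and `q > 3` gives a second moment bounded uniformly in `k`
(`integral_runLength_sq_le`). By Chebyshev the inferior alternatives together use less than half of
the budget with probability tending to 1, and then the best one has the largest sample size. Hence
`liminf PCS ≥ Pr{U₁* ≥ μ₁ - g}`.

Finally let `g` increase to `γ₀`. The probability is left-continuous there because the `U₁(n)` are
atomless and tend to `μ₁`, so that only finitely many sizes matter
(`measureReal_le_ucbInf_le_of_tendsto`). It is positive because a random walk with positive drift
has positive probability of never going below its start (`measure_forall_sum_nonneg_pos`). -/

/-! ### Elementary inequalities for exponentials and powers -/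

theorem exp_le_quadratic_of_nonpos {u : ℝ} (hu : u ≤ 0) : Real.exp u ≤ 1 + u + u ^ 2 / 2 := by
  have h := Real.quadratic_le_exp_of_nonneg (x := -u) (by linarith)
  have hp : Real.exp u * Real.exp (-u) = 1 := by rw [← Real.exp_add]; simp
  have h1 : Real.exp u * (1 + -u + (-u) ^ 2 / 2) ≤ 1 :=
    (mul_le_mul_of_nonneg_left h (Real.exp_pos u).le).trans hp.le
  have h2 : 1 ≤ (1 + u + u ^ 2 / 2) * (1 + -u + (-u) ^ 2 / 2) := by
    nlinarith [sq_nonneg (u ^ 2)]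
  exact le_of_mul_le_mul_right (h1.trans h2) (by nlinarith [sq_nonneg u])

theorem exp_le_add_exp_mul_sq_of_nonneg {v : ℝ} (hv : 0 ≤ v) :
    Real.exp v ≤ 1 + v + Real.exp v * v ^ 2 / 2 := by
  have hd : ∀ t : ℝ, HasDerivAt (fun t => 1 + t + Real.exp t * t ^ 2 / 2 - Real.exp t)
      (1 + (Real.exp t * t ^ 2 + Real.exp t * (2 * t)) / 2 - Real.exp t) t := by
    intro t
    have h1 := ((Real.hasDerivAt_exp t).mul ((hasDerivAt_id t).pow 2)).div_const 2
    have h2 := (((hasDerivAt_id t).const_add 1).add h1).sub (Real.hasDerivAt_exp t)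
    convert! h2 using 1
    simp
  have hm : MonotoneOn (fun t => 1 + t + Real.exp t * t ^ 2 / 2 - Real.exp t) (Set.Ici 0) := by
    apply monotoneOn_of_deriv_nonneg (convex_Ici 0)
    · exact fun t _ => (hd t).continuousAt.continuousWithinAt
    · exact fun t _ => (hd t).differentiableAt.differentiableWithinAt
    · intro t _
      rw [(hd t).deriv]
      have h1 := Real.add_one_le_exp (-t)
      have h2 : Real.exp t * Real.exp (-t) = 1 := by rw [← Real.exp_add]; simp
      have h3 : Real.exp t * (1 - t) ≤ 1 := by
        rw [← h2]; gcongr; linarith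
      have h4 : 0 ≤ Real.exp t * t ^ 2 := by positivity
      nlinarith
  have h := hm (Set.mem_Ici.2 le_rfl) (Set.mem_Ici.2 hv) hv
  simp only [Real.exp_zero] at h
  linarith

theorem exp_le_one_add_add_of_le {q v : ℝ} (hv : v ≤ q) (hq : 0 ≤ q) :
    Real.exp v ≤ 1 + v + Real.exp q * v ^ 2 / 2 := by
  rcases le_total v 0 with h | h
  · have h1 := exp_le_quadratic_of_nonpos h
    have h2 : 1 ≤ Real.exp q := Real.one_le_exp hq
    nlinarith [sq_nonneg v]
  · have h1 := exp_le_add_exp_mul_sq_of_nonneg h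
    have h2 : Real.exp v ≤ Real.exp q := Real.exp_le_exp.2 hv
    nlinarith [sq_nonneg v]

/-- `exp v / v ^ q` increases for `v ≥ q`. -/
theorem exp_le_rpow_mul_exp_div {q v w : ℝ} (hq : 0 < q) (hv : q ≤ v) (hvw : v ≤ w) :
    Real.exp v ≤ v ^ q * (Real.exp w / w ^ q) := by
  have hv0 : 0 < v := hq.trans_le hv
  have hw0 : 0 < w := hv0.trans_le hvw
  have h1 : Real.log (w / v) ≤ w / v - 1 := Real.log_le_sub_one_of_pos (by positivity)
  have h2 : q * Real.log (w / v) ≤ w - v := by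
    have : q * (w / v - 1) ≤ w - v := by
      have e : w - v = v * (w / v - 1) := by field_simp
      have : 0 ≤ w / v - 1 := by rw [sub_nonneg, one_le_div hv0]; exact hvw
      rw [e]; gcongr
    exact (mul_le_mul_of_nonneg_left h1 hq.le).trans this
  rw [Real.log_div hw0.ne' hv0.ne'] at h2
  rw [Real.rpow_def_of_pos hv0, Real.rpow_def_of_pos hw0, ← Real.exp_sub, ← Real.exp_add]
  apply Real.exp_le_exp.2
  linarith

/-- Convexity bound with weight `λ = (1 + (87/100) / (q - 1)) / 2`. -/
theorem add_one_rpow_le {q x : ℝ} (hq : 3 ≤ q) (hx : 0 ≤ x) :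
    (x + 1) ^ q ≤ 2 ^ q / 3.74 * x ^ q + 6 * (2 ^ q / 3.74) := by
  set p := q - 1 with hp
  have hp2 : 2 ≤ p := by linarith
  set τ : ℝ := 0.87 / p with hτ
  have hτ0 : 0 < τ := by positivity
  have hτ1 : τ ≤ 0.435 := by rw [hτ, div_le_iff₀ (by linarith)]; nlinarith
  have hpτ : p * τ = 0.87 := by rw [hτ]; field_simp
  set l : ℝ := (1 + τ) / 2 with hl
  have hl0 : 0 < l := by positivity
  have hl1 : 0 < 1 - l := by rw [hl]; linarith
  have hconv := (convexOn_rpow (p := q) (by linarith)).2 (x := x / l) (y := 1 / (1 - l))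
    (Set.mem_Ici.2 (by positivity)) (Set.mem_Ici.2 (one_div_nonneg.2 hl1.le)) hl0.le hl1.le (by ring)
  simp only [smul_eq_mul] at hconv
  have e1 : l * (x / l) + (1 - l) * (1 / (1 - l)) = x + 1 := by field_simp
  rw [e1] at hconv
  have t2 : (2 : ℝ) ^ q = 2 * 2 ^ p := by
    rw [show q = 1 + p by rw [hp]; ring, Real.rpow_add (by norm_num), Real.rpow_one]
  have aux : ∀ u : ℝ, 0 < u → u * (1 / u) ^ q = 1 / u ^ p := by
    intro u hu
    rw [Real.div_rpow (by norm_num) hu.le, Real.one_rpow,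
      show q = 1 + p by rw [hp]; ring, Real.rpow_add hu, Real.rpow_one]
    field_simp
  -- Bernoulli with `p τ = 0.87`; the constant 3.74 is twice 1.87, the factor 2 coming from `2 ^ q =
  -- 2 * 2 ^ p`.
  have b1 : 1.87 ≤ (1 + τ) ^ p := by
    have := one_add_mul_self_le_rpow_one_add (s := τ) (by linarith) (p := p) (by linarith)
    rw [hpτ] at this; linarith
  -- Bernoulli at exponent `p / 2`, then squared: `0.565² = 0.319225`. At exponent `p` it would give
  -- only 0.13. This needs `p / 2 ≥ 1`, that is `q ≥ 3`.
  have b2 : 0.319225 ≤ (1 - τ) ^ p := by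
    have := one_add_mul_self_le_rpow_one_add (s := -τ) (by linarith) (p := p / 2) (by linarith)
    have h3 : (0.565 : ℝ) ≤ (1 + -τ) ^ (p / 2) := by
      have : p / 2 * -τ = -0.435 := by linarith
      linarith
    have h4 : (1 - τ) ^ p = ((1 + -τ) ^ (p / 2)) ^ 2 := by
      rw [← Real.rpow_natCast, ← Real.rpow_mul (by linarith)]
      congr 1; push_cast; ring
    rw [h4]; nlinarith
  have c1 : l * (x / l) ^ q ≤ 2 ^ q / 3.74 * x ^ q := by
    have : l * (x / l) ^ q = (l * (1 / l) ^ q) * x ^ q := by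
      rw [Real.div_rpow hx hl0.le, Real.div_rpow zero_le_one hl0.le, Real.one_rpow]; ring
    rw [this, aux l hl0, t2]
    apply mul_le_mul_of_nonneg_right _ (by positivity)
    rw [hl, Real.div_rpow (by linarith) (by norm_num), one_div_div, div_le_div_iff₀ (by positivity) (by norm_num)]
    have : (0:ℝ) < 2 ^ p := by positivity
    nlinarith
  have c2 : (1 - l) * (1 / (1 - l)) ^ q ≤ 6 * (2 ^ q / 3.74) := by
    rw [aux _ hl1, t2, show 1 - l = (1 - τ) / 2 by rw [hl]; ring,
      Real.div_rpow (by linarith) (by norm_num), one_div_div, div_le_iff₀ (by linarith)]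
    have : (0:ℝ) < 2 ^ p := by positivity
    have h5 : 1 ≤ 6 * 2 / 3.74 * (1 - τ) ^ p := by nlinarith
    calc (2:ℝ) ^ p = 2 ^ p * 1 := by ring
      _ ≤ 2 ^ p * (6 * 2 / 3.74 * (1 - τ) ^ p) := by gcongr
      _ = _ := by ring
  linarith

theorem two_rpow_ge {q : ℝ} (hq : 3 ≤ q) : 2 ≤ (2 : ℝ) ^ q / 3.74 := by
  have : (2:ℝ) ^ (3:ℝ) ≤ 2 ^ q := Real.rpow_le_rpow_of_exponent_le (by norm_num) hq
  norm_num at this ⊢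
  linarith

/-- The constant term of the convexity bound is replaced by a multiple of `x + 1`. After rescaling
this becomes a multiple of the centred variable, which vanishes in expectation. -/
theorem posPart_add_one_rpow_le {q x : ℝ} (hq : 3 ≤ q) :
    (max (x + 1) 0) ^ q ≤ 2 ^ q / 3.74 * |x| ^ q + 6 * (2 ^ q / 3.74) * (x + 1) := by
  have ha := two_rpow_ge hq
  set a : ℝ := 2 ^ q / 3.74 with hadef
  rcases le_total 0 x with h | h
  · rw [max_eq_left (by linarith), abs_of_nonneg h]
    have := add_one_rpow_le hq h
    rw [← hadef] at this
    nlinarith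
  · rcases le_total (-1) x with h1 | h1
    · rw [max_eq_left (by linarith)]
      have h2 : (x + 1) ^ q ≤ (x + 1) ^ (1:ℝ) :=
        Real.rpow_le_rpow_of_exponent_ge' (by linarith) (by linarith) (by norm_num) (by linarith)
      rw [Real.rpow_one] at h2
      have : 0 ≤ a * |x| ^ q := by positivity
      nlinarith
    · rw [max_eq_right (by linarith), Real.zero_rpow (by linarith), abs_of_nonpos h]
      have h3 : (-x) ^ (3:ℝ) ≤ (-x) ^ q := Real.rpow_le_rpow_of_exponent_le (by linarith) hq
      have h4 : (-x) ^ (3:ℝ) = (-x) ^ 3 := by norm_cast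
      have h5 : 6 * (-x - 1) ≤ (-x) ^ 3 := by
        nlinarith [mul_nonneg (sub_nonneg.2 h1) (sq_nonneg (x + 1.4)), sq_nonneg (x + 1.4)]
      rw [h4] at h3
      nlinarith [mul_le_mul_of_nonneg_left (h5.trans h3) (by linarith : 0 ≤ a)]

theorem posPart_add_rpow_le {q x m : ℝ} (hq : 3 ≤ q) (hm : 0 < m) :
    (max (x + m) 0) ^ q
      ≤ 2 ^ q / 3.74 * |x| ^ q + 6 * (2 ^ q / 3.74) * m ^ (q - 1) * (x + m) := by
  have h := posPart_add_one_rpow_le (x := x / m) hq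
  have h2 := mul_le_mul_of_nonneg_left h (Real.rpow_nonneg hm.le q)
  have e1 : max (x + m) 0 = m * max (x / m + 1) 0 := by
    rw [mul_max_of_nonneg _ _ hm.le]; congr 1
    · field_simp
    · simp
  have e2 : |x| = m * |x / m| := by rw [abs_div, abs_of_pos hm]; field_simp
  have e3 : m ^ q = m ^ (q - 1) * m := by
    rw [← Real.rpow_add_one hm.ne']; congr 1; ring
  have e4 : x + m = m * (x / m + 1) := by field_simp
  rw [e1, e2, Real.mul_rpow hm.le (by positivity), Real.mul_rpow hm.le (by positivity)]
  calc _ ≤ _ := h2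
    _ = 2 ^ q / 3.74 * (m ^ q * |x / m| ^ q) + 6 * (2 ^ q / 3.74) * (m ^ q * (x / m + 1)) := by ring
    _ = _ := by rw [e3]; rw [e4]; field_simp

/-! ### Moments of a centred observation -/

section Moments
variable {ν : Measure ℝ} [IsProbabilityMeasure ν] {q M : ℝ}

theorem integrable_id_of_rpow (hq : 3 ≤ q) (hi : Integrable (fun x : ℝ => |x| ^ q) ν) :
    Integrable (fun x : ℝ => x) ν := by
  refine Integrable.mono' (hi.add (integrable_const 1)) (by fun_prop) (ae_of_all _ fun x => ?_)
  simp only [Real.norm_eq_abs, Pi.add_apply]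
  rcases le_total |x| 1 with h | h
  · have : 0 ≤ |x| ^ q := by positivity
    linarith
  · have := Real.self_le_rpow_of_one_le h (y := q) (by linarith)
    linarith

/-- Pointwise form of Jensen's inequality: the tangent line at `|x| ^ q = M`, obtained from
Bernoulli. -/
theorem sq_le_rpow_div {q M : ℝ} (hq : 3 ≤ q) (hM : 0 < M) (x : ℝ) :
    x ^ 2 ≤ M ^ (2 / q) * (1 + 2 / q * (|x| ^ q / M - 1)) := by
  have hs : 0 < M ^ (2 / q) := by positivity
  have h := one_add_mul_self_le_rpow_one_add (s := x ^ 2 / M ^ (2 / q) - 1)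
    (by have : 0 ≤ x ^ 2 / M ^ (2 / q) := by positivity
        linarith) (p := q / 2) (by linarith)
  have e : (1 + (x ^ 2 / M ^ (2 / q) - 1)) ^ (q / 2) = |x| ^ q / M := by
    rw [add_sub_cancel, Real.div_rpow (by positivity) hs.le, ← Real.rpow_mul hM.le, ← sq_abs,
      ← Real.rpow_natCast, ← Real.rpow_mul (abs_nonneg x)]
    congr 2
    · push_cast; ring
    · rw [show 2 / q * (q / 2) = 1 by field_simp, Real.rpow_one]
  rw [e] at h
  have h3 : x ^ 2 / M ^ (2 / q) - 1 ≤ 2 / q * (|x| ^ q / M - 1) := by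
    have : x ^ 2 / M ^ (2 / q) - 1 = 2 / q * (q / 2 * (x ^ 2 / M ^ (2 / q) - 1)) := by
      field_simp
    rw [this]
    gcongr; linarith
  have h4 : x ^ 2 = M ^ (2 / q) * (1 + (x ^ 2 / M ^ (2 / q) - 1)) := by field_simp; ring
  rw [h4]; gcongr

theorem integrable_sq_of_rpow (hq : 3 ≤ q) (hi : Integrable (fun x : ℝ => |x| ^ q) ν) :
    Integrable (fun x : ℝ => x ^ 2) ν := by
  refine Integrable.mono' ((hi.const_mul (2 / q)).add (integrable_const 1)) (by fun_prop)
    (ae_of_all _ fun x => ?_)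
  have := sq_le_rpow_div hq one_pos x
  rw [Real.norm_of_nonneg (sq_nonneg x)]
  have h2 : 0 < 2 / q := by positivity
  simp only [Real.one_rpow, div_one, one_mul, Pi.add_apply] at *
  linarith

theorem integral_sq_le (hq : 3 ≤ q) (hM : 0 < M) (hi : Integrable (fun x : ℝ => |x| ^ q) ν)
    (hle : ∫ x, |x| ^ q ∂ν ≤ M) : ∫ x, x ^ 2 ∂ν ≤ M ^ (2 / q) := by
  set s := M ^ (2 / q) with hs
  have hI : Integrable (fun x : ℝ => s * (2 / q) / M * |x| ^ q + s * (1 - 2 / q)) ν :=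
    (hi.const_mul _).add (integrable_const _)
  have h := integral_mono (integrable_sq_of_rpow hq hi) hI
    (fun x => (sq_le_rpow_div hq hM x).trans_eq (by simp only [← hs]; field_simp; ring))
  refine h.trans ?_
  rw [integral_add (hi.const_mul _) (integrable_const _), integral_const_mul]
  simp only [integral_const, probReal_univ, one_smul]
  have h0 : 0 ≤ s * (2 / q) / M := by positivity
  calc _ ≤ s * (2 / q) / M * M + s * (1 - 2 / q) := by gcongr
    _ = s := by field_simp; ring

/-- Only the positive part matters for an upper tail, and this gains a factor 3.74 over the crude `2
^ q`. For a nonnegative mean, `(x - μ)₊ ≤ |x|`; for a negative mean, `posPart_add_rpow_le` applies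
with `m = -μ` and its linear term integrates to zero. -/
theorem posPart_sub_mean_rpow_le (hq : 3 ≤ q) (hi : Integrable (fun x : ℝ => |x| ^ q) ν) :
    Integrable (fun x : ℝ => (max (x - ∫ y, y ∂ν) 0) ^ q) ν ∧
      ∫ x, (max (x - ∫ y, y ∂ν) 0) ^ q ∂ν ≤ 2 ^ q / 3.74 * ∫ x, |x| ^ q ∂ν := by
  set μ := ∫ y, y ∂ν with hμ
  have hid := integrable_id_of_rpow hq hi
  have ha := two_rpow_ge hq
  have main : ∃ c : ℝ, ∀ x : ℝ, (max (x - μ) 0) ^ q ≤ 2 ^ q / 3.74 * |x| ^ q + c * (x - μ) := by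
    rcases le_or_gt 0 μ with h | h
    · refine ⟨0, fun x => ?_⟩
      have h1 : (max (x - μ) 0) ^ q ≤ |x| ^ q := by
        apply Real.rpow_le_rpow (le_max_right _ _) _ (by linarith)
        exact max_le (by linarith [le_abs_self x]) (abs_nonneg x)
      have : 0 ≤ |x| ^ q := by positivity
      nlinarith
    · refine ⟨6 * (2 ^ q / 3.74) * (-μ) ^ (q - 1), fun x => ?_⟩
      have := posPart_add_rpow_le (x := x) (m := -μ) hq (by linarith)
      simpa [sub_eq_add_neg] using this
  obtain ⟨c, hc⟩ := main
  have hJ : Integrable (fun x : ℝ => c * (x - μ)) ν :=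
    (hid.sub (integrable_const μ)).const_mul c
  have hI : Integrable (fun x : ℝ => 2 ^ q / 3.74 * |x| ^ q + c * (x - μ)) ν :=
    (hi.const_mul _).add hJ
  have hI2 : Integrable (fun x : ℝ => (max (x - μ) 0) ^ q) ν := by
    refine hI.mono' (Measurable.aestronglyMeasurable (by fun_prop)) (ae_of_all _ fun x => ?_)
    rw [Real.norm_of_nonneg (by positivity)]
    exact hc x
  refine ⟨hI2, (integral_mono hI2 hI hc).trans ?_⟩
  rw [integral_add (hi.const_mul _) hJ,
    integral_const_mul, integral_const_mul, integral_sub hid (integrable_const μ)]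
  simp [← hμ]

end Moments

/-! ### One-sided Fuk–Nagaev inequality -/

/-- `x` truncated to `0` above the level `y`. -/
noncomputable def truncAbove (y x : ℝ) : ℝ := if x ≤ y then x else 0

theorem measurable_truncAbove (y : ℝ) : Measurable (truncAbove y) :=
  Measurable.ite measurableSet_Iic measurable_id measurable_const

theorem truncAbove_le {y : ℝ} (hy : 0 < y) (x : ℝ) : truncAbove y x ≤ y := by
  unfold truncAbove; split_ifs <;> linarith

/-- The contribution of the large jumps to the exponential moment. -/
noncomputable def jumpWeight (q y h : ℝ) : ℝ := if q < h * y then Real.exp (h * y) / y ^ q else 0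

theorem jumpWeight_nonneg {q y h : ℝ} (hy : 0 < y) : 0 ≤ jumpWeight q y h := by
  unfold jumpWeight; split_ifs <;> positivity

/-- While the exponent is at most `q`, a second-order Taylor bound with factor `exp q` suffices.
Beyond `q`, the monotonicity of `exp v / v ^ q` compares it with its value at `v = h * y`. The
linear term is left untruncated so that it has mean zero. -/
theorem exp_mul_truncAbove_le {q y h : ℝ} (hq : 0 < q) (hy : 0 < y) (hh : 0 < h) (x : ℝ) :
    Real.exp (h * truncAbove y x)
      ≤ 1 + h * x + Real.exp q * h ^ 2 / 2 * x ^ 2 + jumpWeight q y h * (max x 0) ^ q := by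
  have hD := jumpWeight_nonneg (q := q) (h := h) hy
  have hE : 0 < Real.exp q := Real.exp_pos q
  have hpos : 0 ≤ (max x 0) ^ q := by positivity
  have hZle : truncAbove y x ≤ x := by
    unfold truncAbove; split_ifs <;> linarith
  have hZsq : truncAbove y x ^ 2 ≤ x ^ 2 := by
    unfold truncAbove; split_ifs
    · exact le_rfl
    · nlinarith [sq_nonneg x]
  rcases le_or_gt (h * truncAbove y x) q with hc | hc
  · have h1 := exp_le_one_add_add_of_le hc hq.le
    have h2 : h * truncAbove y x ≤ h * x := by gcongr
    have h3 : Real.exp q * h ^ 2 / 2 * truncAbove y x ^ 2 ≤ Real.exp q * h ^ 2 / 2 * x ^ 2 := by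
      gcongr
    have h4 := mul_nonneg hD hpos
    nlinarith
  · have hxy : x ≤ y := by
      by_contra hcon
      simp only [truncAbove, hcon, if_false, mul_zero] at hc
      linarith
    simp only [truncAbove, hxy, if_true] at hc ⊢
    have hx : 0 < x := by
      by_contra hcon
      nlinarith
    have hxy' : h * x ≤ h * y := by gcongr
    have h1 := exp_le_rpow_mul_exp_div hq hc.le hxy'
    rw [Real.mul_rpow hh.le hx.le, Real.mul_rpow hh.le hy.le] at h1
    rw [jumpWeight, if_pos (hc.trans_le hxy'), max_eq_left hx.le]
    have h2 : h ^ q * x ^ q * (Real.exp (h * y) / (h ^ q * y ^ q))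
        = Real.exp (h * y) / y ^ q * x ^ q := by
      have : 0 < h ^ q := by positivity
      field_simp
    rw [h2] at h1
    have h3 : 0 ≤ Real.exp q * h ^ 2 / 2 * x ^ 2 := by positivity
    have h4 : 0 < h * x := by positivity
    linarith

/-- The choice of the exponential tilt. -/
theorem exists_tilt {V x α β q r : ℝ} (hV : 0 < V) (hx : 0 < x) (hα : 0 < α) (hβ : 0 < β)
    (hαβ : α + β = 1) (hq : 1 ≤ q) (hr : 1 < r) :
    ∃ h, 0 < h ∧
      (-h * x + V * h ^ 2 / 2 + (if q < h * (β * x) then Real.exp (h * (β * x)) / r else 0)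
          ≤ -(α ^ 2 * x ^ 2 / (2 * V)) ∨
       -h * x + V * h ^ 2 / 2 + (if q < h * (β * x) then Real.exp (h * (β * x)) / r else 0)
          ≤ 1 - Real.log r) := by
  have hβx : 0 < β * x := by positivity
  have hlog : 0 < Real.log r := Real.log_pos hr
  have hr0 : 0 < r := by linarith
  have hβe : β = 1 - α := by linarith
  rcases le_or_gt (α * x / V * (β * x)) (Real.log r) with hc | hc
  -- The Gaussian optimum for the share `α x` of the deviation. The jump term is at most 1 and
  -- occurs only when `h β x > q ≥ 1`, so the remaining share `β x` absorbs it.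
  · refine ⟨α * x / V, by positivity, Or.inl ?_⟩
    have e1 : V * (α * x / V) ^ 2 / 2 - α * x * (α * x / V) = -(α ^ 2 * x ^ 2 / (2 * V)) := by
      field_simp; ring
    have e2 : (if q < α * x / V * (β * x) then Real.exp (α * x / V * (β * x)) / r else 0)
        ≤ α * x / V * (β * x) := by
      split_ifs with hi
      · have : Real.exp (α * x / V * (β * x)) ≤ r := by
          rw [← Real.exp_log hr0]; exact Real.exp_le_exp.2 hc
        have : Real.exp (α * x / V * (β * x)) / r ≤ 1 := by rwa [div_le_one hr0]
        linarith
      · positivity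
    have e3 : α * x / V * (β * x) = α * x / V * x - α * x * (α * x / V) := by rw [hβe]; ring
    linarith
  -- The smaller tilt makes the jump term at most 1, while `V h ≤ α x` lets the share `α x` pay for
  -- the quadratic term; what remains is `-log r`.
  · set h := Real.log r / (β * x) with hh
    have hhy : h * (β * x) = Real.log r := by rw [hh]; field_simp
    have hh0 : 0 < h := by positivity
    refine ⟨h, hh0, Or.inr ?_⟩
    rw [hhy, Real.exp_log hr0, div_self hr0.ne']
    have e1 : (if q < Real.log r then (1:ℝ) else 0) ≤ 1 := by split_ifs <;> norm_num
    have e2 : h ≤ α * x / V := by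
      rw [hh, div_le_iff₀ hβx]; exact hc.le
    have e3 : V * h ≤ α * x := by rw [le_div_iff₀ hV] at e2; linarith
    have e4 : V * h * h ≤ α * x * h := by gcongr
    have e5 : h * x = α * x * h + Real.log r := by rw [← hhy, hβe]; ring
    have e6 : 0 < α * x * h := by positivity
    nlinarith

section Nagaev
variable {Ω : Type*} [MeasurableSpace Ω] {P : Measure Ω} [IsProbabilityMeasure P]

theorem integrable_exp_mul_truncAbove {Y : Ω → ℝ} (hY : Measurable Y) {y h : ℝ} (hy : 0 < y)
    (hh : 0 < h) : Integrable (fun ω => Real.exp (h * truncAbove y (Y ω))) P := by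
  have hm := (measurable_truncAbove y).comp hY
  refine Integrable.mono' (integrable_const (Real.exp (h * y)))
    (Measurable.aestronglyMeasurable (by fun_prop)) (ae_of_all _ fun ω => ?_)
  rw [Real.norm_of_nonneg (Real.exp_pos _).le]
  have := truncAbove_le hy (Y ω)
  gcongr

theorem mgf_truncAbove_le {Y : Ω → ℝ} (hY : Measurable Y) {q y h v m : ℝ} (hq : 0 < q) (hy : 0 < y)
    (hh : 0 < h) (hint : Integrable Y P) (hmean : ∫ ω, Y ω ∂P = 0)
    (hsq : Integrable (fun ω => Y ω ^ 2) P) (hv : ∫ ω, Y ω ^ 2 ∂P ≤ v)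
    (hpi : Integrable (fun ω => (max (Y ω) 0) ^ q) P) (hm : ∫ ω, (max (Y ω) 0) ^ q ∂P ≤ m) :
    mgf (fun ω => truncAbove y (Y ω)) P h
      ≤ Real.exp (Real.exp q * h ^ 2 / 2 * v + jumpWeight q y h * m) := by
  have i1 : Integrable (fun ω => 1 + h * Y ω) P := (integrable_const 1).add (hint.const_mul h)
  have i2 : Integrable (fun ω => 1 + h * Y ω + Real.exp q * h ^ 2 / 2 * Y ω ^ 2) P :=
    i1.add (hsq.const_mul _)
  have h1 := integral_mono (integrable_exp_mul_truncAbove hY hy hh) (i2.add (hpi.const_mul _))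
    (fun ω => exp_mul_truncAbove_le hq hy hh (Y ω))
  rw [Pi.add_def, integral_add i2 (hpi.const_mul _), integral_add i1 (hsq.const_mul _),
    integral_add (integrable_const 1) (hint.const_mul h), integral_const_mul, integral_const_mul,
    integral_const_mul, hmean] at h1
  simp only [integral_const, probReal_univ, one_smul, mul_zero, add_zero] at h1
  have hD := jumpWeight_nonneg (q := q) (h := h) hy
  have hE : 0 ≤ Real.exp q * h ^ 2 / 2 := by positivity
  have h2 := mul_le_mul_of_nonneg_left hv hE
  have h3 := mul_le_mul_of_nonneg_left hm hD
  have h4 := Real.add_one_le_exp (Real.exp q * h ^ 2 / 2 * v + jumpWeight q y h * m)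
  unfold mgf
  linarith

theorem measureReal_lt_le_of_posPart {Y : Ω → ℝ} {q y m : ℝ} (hq : 0 < q) (hy : 0 < y)
    (hpi : Integrable (fun ω => (max (Y ω) 0) ^ q) P) (hm : ∫ ω, (max (Y ω) 0) ^ q ∂P ≤ m) :
    P.real {ω | y < Y ω} ≤ m / y ^ q := by
  have h := mul_meas_ge_le_integral_of_nonneg (μ := P)
    (ae_of_all _ fun ω => by positivity : 0 ≤ᵐ[P] fun ω => (max (Y ω) 0) ^ q) hpi (y ^ q)
  have hyq : 0 < y ^ q := by positivity
  rw [le_div_iff₀ hyq, mul_comm]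
  refine le_trans ?_ (h.trans hm)
  have hsub : {ω | y < Y ω} ⊆ {ω | y ^ q ≤ (max (Y ω) 0) ^ q} := fun ω hω =>
    Real.rpow_le_rpow hy.le ((le_of_lt hω).trans (le_max_left _ _)) hq.le
  exact mul_le_mul_of_nonneg_left (measureReal_mono hsub) hyq.le

/-- A one-sided Fuk-Nagaev inequality for sums of i.i.d. centred random variables. -/
theorem measureReal_sum_ge_le_fukNagaev {Y : ℕ → Ω → ℝ} (hY : ∀ j, Measurable (Y j))
    (hind : iIndepFun Y P) (hid : ∀ j, IdentDistrib (Y j) (Y 0) P P)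
    {q v m : ℝ} (hq : 1 ≤ q) (hv0 : 0 < v) (hm0 : 0 < m)
    (hint : Integrable (Y 0) P) (hmean : ∫ ω, Y 0 ω ∂P = 0)
    (hsq : Integrable (fun ω => Y 0 ω ^ 2) P) (hv : ∫ ω, Y 0 ω ^ 2 ∂P ≤ v)
    (hpi : Integrable (fun ω => (max (Y 0 ω) 0) ^ q) P)
    (hm : ∫ ω, (max (Y 0 ω) 0) ^ q ∂P ≤ m)
    {n : ℕ} (hn : 1 ≤ n) {x : ℝ} (hx : 0 < x) :
    P.real {ω | x ≤ ∑ j ∈ Finset.range n, Y j ω}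
      ≤ (1 + Real.exp 1) * (n * m / (q / (q + 2) * x) ^ q)
        + Real.exp (-((2 / (q + 2)) ^ 2 * x ^ 2 / (2 * (n * v * Real.exp q)))) := by
  have hq0 : 0 < q := by linarith
  have hn0 : (0 : ℝ) < n := by exact_mod_cast hn
  set y := q / (q + 2) * x with hy
  have hy0 : 0 < y := by positivity
  have hyq : 0 < y ^ q := by positivity
  set r := y ^ q / (n * m) with hr
  have hr0 : 0 < r := by positivity
  have hrinv : n * m / y ^ q = 1 / r := by rw [hr, one_div_div]
  rw [hrinv]
  have hexp1 := Real.exp_pos 1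
  rcases le_or_gt r 1 with hr1 | hr1
  -- For `r ≤ 1` the asserted bound exceeds 1.
  · have h1 : 1 ≤ 1 / r := by rwa [le_div_iff₀ hr0, one_mul]
    have h2 : P.real {ω | x ≤ ∑ j ∈ Finset.range n, Y j ω} ≤ 1 := measureReal_le_one
    have h3 := Real.exp_pos (-((2 / (q + 2)) ^ 2 * x ^ 2 / (2 * (n * v * Real.exp q))))
    nlinarith
  obtain ⟨h, hh, hbound⟩ := exists_tilt (V := n * v * Real.exp q) (x := x) (α := 2 / (q + 2))
    (β := q / (q + 2)) (q := q) (r := r) (by positivity) hx (by positivity) (by positivity)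
    (by field_simp; ring) hq hr1
  rw [← hy] at hbound
  set Z : ℕ → Ω → ℝ := fun j ω => truncAbove y (Y j ω) with hZ
  have hZm : ∀ j, Measurable (Z j) := fun j => (measurable_truncAbove y).comp (hY j)
  have hZind : iIndepFun Z P := hind.comp (fun _ => truncAbove y) (fun _ => measurable_truncAbove y)
  have hZid : ∀ j, IdentDistrib (Z j) (Z 0) P P := fun j => (hid j).comp (measurable_truncAbove y)
  have hmgf : mgf (∑ j ∈ Finset.range n, Z j) P h = mgf (Z 0) P h ^ n := by
    have := mgf_sum_of_identDistrib hZm hZind (s := Finset.range n) (j := 0)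
      (fun i _ j _ => (hZid i).trans (hZid j).symm) (Finset.mem_range.2 hn) h
    simpa using this
  have hsum : P.real {ω | x ≤ (∑ j ∈ Finset.range n, Z j) ω}
      ≤ Real.exp (-h * x + n * v * Real.exp q * h ^ 2 / 2
        + (if q < h * y then Real.exp (h * y) / r else 0)) := by
    have h1 := measure_ge_le_exp_mul_mgf (μ := P) (X := ∑ j ∈ Finset.range n, Z j) x hh.le
      (hZind.integrable_exp_mul_sum hZm fun i _ => integrable_exp_mul_truncAbove (hY i) hy0 hh)
    rw [hmgf] at h1
    have h2 := mgf_truncAbove_le (hY 0) hq0 hy0 hh hint hmean hsq hv hpi hm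
    refine h1.trans ?_
    calc Real.exp (-h * x) * mgf (Z 0) P h ^ n
        ≤ Real.exp (-h * x)
          * Real.exp (Real.exp q * h ^ 2 / 2 * v + jumpWeight q y h * m) ^ n := by
          gcongr
          exact mgf_nonneg
      _ = _ := by
        rw [← Real.exp_nat_mul, ← Real.exp_add]
        congr 1
        have : (if q < h * y then Real.exp (h * y) / r else 0) = n * (jumpWeight q y h * m) := by
          unfold jumpWeight
          split_ifs
          · rw [hr]; field_simp
          · simp
        rw [this]; ring
  have hsum2 : P.real {ω | x ≤ (∑ j ∈ Finset.range n, Z j) ω}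
      ≤ Real.exp (-((2 / (q + 2)) ^ 2 * x ^ 2 / (2 * (n * v * Real.exp q))))
        + Real.exp 1 * (1 / r) := by
    refine hsum.trans ?_
    rcases hbound with hb | hb
    · have := Real.exp_le_exp.2 hb
      have : 0 ≤ Real.exp 1 * (1 / r) := by positivity
      linarith
    · have h1 := Real.exp_le_exp.2 hb
      rw [Real.exp_sub, Real.exp_log hr0, div_eq_mul_one_div (Real.exp 1) r] at h1
      have := Real.exp_pos (-((2 / (q + 2)) ^ 2 * x ^ 2 / (2 * (n * v * Real.exp q))))
      linarith
  have hjump : P.real (⋃ j ∈ Finset.range n, {ω | y < Y j ω}) ≤ 1 / r := by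
    have h1 : ∀ j, P.real {ω | y < Y j ω} ≤ m / y ^ q := by
      intro j
      have : P.real {ω | y < Y j ω} = P.real {ω | y < Y 0 ω} := by
        simp only [measureReal_def]
        congr 1
        exact (hid j).measure_mem_eq (s := Set.Ioi y) measurableSet_Ioi
      rw [this]
      exact measureReal_lt_le_of_posPart hq0 hy0 hpi hm
    calc _ ≤ ∑ j ∈ Finset.range n, P.real {ω | y < Y j ω} := measureReal_biUnion_finset_le _ _
      _ ≤ ∑ j ∈ Finset.range n, m / y ^ q := Finset.sum_le_sum fun j _ => h1 j
      _ = 1 / r := by rw [← hrinv]; simp; ring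
  have hsub : {ω | x ≤ ∑ j ∈ Finset.range n, Y j ω}
      ⊆ (⋃ j ∈ Finset.range n, {ω | y < Y j ω}) ∪ {ω | x ≤ (∑ j ∈ Finset.range n, Z j) ω} := by
    intro ω hω
    by_cases hex : ∃ j ∈ Finset.range n, y < Y j ω
    · left
      simpa using hex
    · right
      push Not at hex
      simp only [Set.mem_ofPred_eq, Finset.sum_apply] at hω ⊢
      rw [Finset.sum_congr rfl fun j hj => show Z j ω = Y j ω by simp [hZ, truncAbove, hex j hj]]
      exact hω
  calc _ ≤ _ := measureReal_mono hsub
    _ ≤ _ := measureReal_union_le _ _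
    _ ≤ _ := by linarith

end Nagaev

/-! ### Observation sequences as a product space -/

/-- The law of the sequence of observations of an alternative with distribution `ν`. -/
noncomputable def seqLaw (ν : Measure ℝ) : Measure (ℕ → ℝ) := Measure.infinitePi fun _ : ℕ => ν

section Coordinates
variable {ν : Measure ℝ} [IsProbabilityMeasure ν]

instance : IsProbabilityMeasure (seqLaw ν) := by unfold seqLaw; infer_instance

theorem hasLaw_coord (j : ℕ) : HasLaw (fun x : ℕ → ℝ => x j) ν (seqLaw ν) :=
  ⟨(measurable_pi_apply j).aemeasurable, Measure.infinitePi_map_eval _ j⟩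

theorem iIndepFun_coord {g : ℝ → ℝ} (hg : Measurable g) :
    iIndepFun (fun (j : ℕ) (x : ℕ → ℝ) => g (x j)) (seqLaw ν) :=
  iIndepFun_infinitePi (X := fun _ => g) fun _ => hg

theorem identDistrib_coord {g : ℝ → ℝ} (hg : Measurable g) (i j : ℕ) :
    IdentDistrib (fun x : ℕ → ℝ => g (x i)) (fun x => g (x j)) (seqLaw ν) (seqLaw ν) := by
  have : IdentDistrib (fun x : ℕ → ℝ => x i) (fun x => x j) (seqLaw ν) (seqLaw ν) :=
    ⟨(measurable_pi_apply i).aemeasurable, (measurable_pi_apply j).aemeasurable,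
      (hasLaw_coord i).map_eq.trans (hasLaw_coord j).map_eq.symm⟩
  exact this.comp hg

theorem integrable_coord_iff {g : ℝ → ℝ} (hg : Measurable g) (j : ℕ) :
    Integrable (fun x : ℕ → ℝ => g (x j)) (seqLaw ν) ↔ Integrable g ν := by
  have h := integrable_map_measure (μ := seqLaw ν) (f := fun x : ℕ → ℝ => x j) (g := g)
    hg.aestronglyMeasurable (measurable_pi_apply j).aemeasurable
  rw [(hasLaw_coord j).map_eq] at h
  exact h.symm

theorem integral_coord {g : ℝ → ℝ} (hg : Measurable g) (j : ℕ) :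
    ∫ x : ℕ → ℝ, g (x j) ∂(seqLaw ν) = ∫ y, g y ∂ν :=
  (hasLaw_coord j).integral_comp hg.aestronglyMeasurable

end Coordinates

/-! ### Tail bounds for sample means and their sums -/

theorem measurable_sampleMean (n : ℕ) : Measurable fun x : ℕ → ℝ => sampleMean x n := by
  unfold sampleMean; fun_prop

theorem measurable_ucb (f : ℕ → ℝ) (n : ℕ) : Measurable fun x : ℕ → ℝ => ucb f x n :=
  (measurable_sampleMean n).add_const _

/-- The ratio of the polynomial part of the tail bound to that in `momentC`. -/
noncomputable def tailRatio : ℝ := (1 + Real.exp 1) / 3.74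

theorem tailRatio_lt_one : tailRatio < 1 := by
  unfold tailRatio
  rw [div_lt_one (by norm_num)]
  linarith [Real.exp_one_lt_d9]

theorem tailRatio_pos : 0 < tailRatio := by
  unfold tailRatio; positivity

/-- The bound on the probability that a sample mean of size `n` exceeds the mean by `b`. -/
noncomputable def tailBound (q M b : ℝ) (n : ℕ) : ℝ :=
  tailRatio * momentA₁ q M * b ^ (-q) * (n : ℝ) ^ (1 - q)
    + Real.exp (-(n * momentC₂ q M * b ^ 2))

theorem momentA₁_pos {q M : ℝ} (hq : 0 < q) (hM : 0 < M) : 0 < momentA₁ q M := by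
  unfold momentA₁; positivity

theorem momentC₂_pos {q M : ℝ} (hq : 0 < q) (hM : 0 < M) : 0 < momentC₂ q M := by
  unfold momentC₂ momentA₂; positivity

theorem tailBound_nonneg {q M b : ℝ} (hq : 0 < q) (hM : 0 < M) (hb : 0 < b) (n : ℕ) :
    0 ≤ tailBound q M b n := by
  have := tailRatio_pos
  have := momentA₁_pos hq hM
  unfold tailBound; positivity

theorem measureReal_sampleMean_ge_le {ν : Measure ℝ} [IsProbabilityMeasure ν] {q M b : ℝ}
    (hq : 3 ≤ q) (hM : 0 < M) (hi : Integrable (fun x : ℝ => |x| ^ q) ν)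
    (hle : ∫ x, |x| ^ q ∂ν ≤ M) (hb : 0 < b) {n : ℕ} (hn : 1 ≤ n) :
    (seqLaw ν).real {x | (∫ y, y ∂ν) + b ≤ sampleMean x n} ≤ tailBound q M b n := by
  have hq0 : 0 < q := by linarith
  have hn0 : (0 : ℝ) < n := by exact_mod_cast hn
  set μ := ∫ y, y ∂ν with hμ
  have hid := integrable_id_of_rpow hq hi
  have hi2 := integrable_sq_of_rpow hq hi
  have hsq : Integrable (fun y : ℝ => (y - μ) ^ 2) ν := by
    have : (fun y : ℝ => (y - μ) ^ 2) = fun y => y ^ 2 - 2 * μ * y + μ ^ 2 := by ext y; ring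
    rw [this]
    exact (hi2.sub (hid.const_mul _)).add (integrable_const _)
  have hsqle : ∫ y, (y - μ) ^ 2 ∂ν ≤ M ^ (2 / q) := by
    have e : ∫ y, (y - μ) ^ 2 ∂ν = ∫ y, y ^ 2 ∂ν - μ ^ 2 := by
      have : (fun y : ℝ => (y - μ) ^ 2) = fun y => (y ^ 2 - 2 * μ * y) + μ ^ 2 := by ext y; ring
      have h1 : Integrable (fun y : ℝ => y ^ 2 - 2 * μ * y) ν := hi2.sub (hid.const_mul _)
      rw [this, integral_add h1 (integrable_const _), integral_sub hi2 (hid.const_mul _),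
        integral_const_mul, ← hμ]
      simp; ring
    have := integral_sq_le hq hM hi hle
    nlinarith [sq_nonneg μ]
  obtain ⟨hpi, hpm⟩ := posPart_sub_mean_rpow_le hq hi
  have hm : ∫ x, (max (x - μ) 0) ^ q ∂ν ≤ 2 ^ q / 3.74 * M :=
    hpm.trans (by gcongr)
  have m1 : Measurable fun y : ℝ => y - μ := by fun_prop
  have m2 : Measurable fun y : ℝ => (y - μ) ^ 2 := by fun_prop
  have m3 : Measurable fun y : ℝ => (max (y - μ) 0) ^ q := by fun_prop
  have key := measureReal_sum_ge_le_fukNagaev (P := seqLaw ν)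
    (Y := fun j x => x j - μ) (fun j => by fun_prop) (iIndepFun_coord m1)
    (fun j => identDistrib_coord m1 j 0) (q := q) (v := M ^ (2 / q)) (m := 2 ^ q / 3.74 * M)
    (by linarith) (by positivity) (by positivity)
    ((integrable_coord_iff m1 0).2 (hid.sub (integrable_const _)))
    (by rw [integral_coord m1 0, integral_sub hid (integrable_const _)]; simp [hμ])
    ((integrable_coord_iff m2 0).2 hsq) ((integral_coord m2 0).trans_le hsqle)
    ((integrable_coord_iff m3 0).2 hpi) ((integral_coord m3 0).trans_le hm) hn
    (x := n * b) (by positivity)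
  have hset : {x : ℕ → ℝ | μ + b ≤ sampleMean x n}
      = {x | n * b ≤ ∑ j ∈ Finset.range n, (x j - μ)} := by
    ext x
    simp only [Set.mem_ofPred_eq, sampleMean, Finset.sum_sub_distrib, Finset.sum_const,
      Finset.card_range, nsmul_eq_mul]
    rw [le_div_iff₀ hn0]
    constructor <;> intro h <;> linarith
  rw [hset]
  refine key.trans ?_
  unfold tailBound
  apply add_le_add
  · apply le_of_eq
    have e1 : (2 + 4 / q : ℝ) = 2 * ((q + 2) / q) := by field_simp; ring
    unfold tailRatio momentA₁
    rw [e1, Real.mul_rpow (x := 2) (y := (q + 2) / q) (by norm_num) (by positivity),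
      Real.mul_rpow (x := q / (q + 2)) (y := n * b) (by positivity) (by positivity),
      Real.mul_rpow hn0.le hb.le, Real.div_rpow hq0.le (by positivity),
      Real.div_rpow (by positivity) hq0.le, Real.rpow_neg hb.le, Real.rpow_sub hn0, Real.rpow_one]
    field_simp
  · apply Real.exp_le_exp.2
    apply neg_le_neg
    unfold momentC₂ momentA₂
    rw [show (-2 : ℝ) / q = -(2 / q) by ring, Real.rpow_neg hM.le, Real.exp_neg,
      Real.rpow_neg (by positivity), show (2 : ℝ) = ((2 : ℕ) : ℝ) by norm_num, Real.rpow_natCast]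
    have hs : 0 < M ^ ((2:ℕ) / q) := by positivity
    have hE := Real.exp_pos q
    push_cast at hs ⊢
    -- The Fuk–Nagaev exponent is four times the required one, since `α = 2 / (q + 2)` enters
    -- squared; the surplus is discarded.
    rw [show (n : ℝ) * (((q + 2) ^ 2)⁻¹ * (Real.exp q)⁻¹ * (M ^ (2 / q))⁻¹ / 2) * b ^ 2
      = 1 * (n * b ^ 2 / (2 * (q + 2) ^ 2 * Real.exp q * M ^ (2 / q))) by field_simp,
      show (2 / (q + 2)) ^ 2 * (n * b) ^ 2 / (2 * (n * M ^ (2 / q) * Real.exp q))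
      = 4 * (n * b ^ 2 / (2 * (q + 2) ^ 2 * Real.exp q * M ^ (2 / q))) by field_simp; ring]
    gcongr
    norm_num

/-- Telescoping comparison with the integral of `u ^ (1 - q)`. The first term is bounded by `N ^ (2
- q)` and the rest by `N ^ (2 - q) / (q - 2)`. -/
theorem sum_Ico_rpow_le {q : ℝ} (hq : 3 ≤ q) {N : ℕ} (hN : 1 ≤ N) (B : ℕ) :
    ∑ n ∈ Finset.Ico N B, (n : ℝ) ^ (1 - q) ≤ (N : ℝ) ^ (-q + 2) * ((q - 1) / (q - 2)) := by
  have hN0 : (1 : ℝ) ≤ N := by exact_mod_cast hN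
  have step : ∀ u : ℝ, 1 ≤ u →
      (u + 1) ^ (1 - q) ≤ (u ^ (2 - q) - (u + 1) ^ (2 - q)) / (q - 2) := by
    intro u hu
    have hu0 : 0 < u := by linarith
    have hb := one_add_mul_self_le_rpow_one_add (s := 1 / u) (p := q - 2)
      (by have : 0 < 1 / u := by positivity
          linarith) (by linarith)
    have e1 : u ^ (2 - q) = (1 + 1 / u) ^ (q - 2) * (u + 1) ^ (2 - q) := by
      rw [show 1 + 1 / u = (u + 1) / u by field_simp, Real.div_rpow (by linarith) hu0.le,
        show 2 - q = -(q - 2) by ring, Real.rpow_neg hu0.le, Real.rpow_neg (by linarith)]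
      field_simp
    have e2 : (u + 1) ^ (1 - q) = (u + 1) ^ (2 - q) / (u + 1) := by
      rw [show 1 - q = 2 - q - 1 by ring, Real.rpow_sub_one (by linarith)]
    have hw : 0 < (u + 1) ^ (2 - q) := by positivity
    rw [le_div_iff₀ (by linarith), e1, e2]
    have h3 : (q - 2) / (u + 1) ≤ (q - 2) * (1 / u) := by
      rw [mul_one_div]
      apply div_le_div_of_nonneg_left <;> linarith
    calc (u + 1) ^ (2 - q) / (u + 1) * (q - 2) = (u + 1) ^ (2 - q) * ((q - 2) / (u + 1)) := by ring
      _ ≤ (u + 1) ^ (2 - q) * ((1 + 1 / u) ^ (q - 2) - 1) := by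
        gcongr; linarith
      _ = _ := by ring
  have tele : ∀ k : ℕ, ∑ n ∈ Finset.Ico N (N + k + 1), (n : ℝ) ^ (1 - q)
      ≤ (N : ℝ) ^ (1 - q) + ((N : ℝ) ^ (2 - q) - (N + k : ℝ) ^ (2 - q)) / (q - 2) := by
    intro k
    induction k with
    | zero => simp
    | succ k ih =>
      rw [← add_assoc N k 1, Finset.sum_Ico_succ_top (by omega)]
      have := step (N + k) (by linarith [(Nat.cast_nonneg k : (0:ℝ) ≤ k)])
      push_cast at ih ⊢
      have e : (N : ℝ) ^ (1 - q) + ((N : ℝ) ^ (2 - q) - (N + (k + 1) : ℝ) ^ (2 - q)) / (q - 2)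
        = (N : ℝ) ^ (1 - q) + ((N : ℝ) ^ (2 - q) - (N + k : ℝ) ^ (2 - q)) / (q - 2)
          + ((N + k : ℝ) ^ (2 - q) - (N + k + 1 : ℝ) ^ (2 - q)) / (q - 2) := by
        rw [← add_assoc (N : ℝ) k 1]; ring
      rw [e]
      linarith
  have h1 : (N : ℝ) ^ (1 - q) ≤ (N : ℝ) ^ (2 - q) :=
    Real.rpow_le_rpow_of_exponent_le hN0 (by linarith)
  rw [show -q + 2 = 2 - q by ring]
  have hw : 0 < (N : ℝ) ^ (2 - q) := by positivity
  rcases lt_or_ge N B with h | h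
  · obtain ⟨k, rfl⟩ : ∃ k, B = N + k + 1 := ⟨B - N - 1, by omega⟩
    refine (tele k).trans ?_
    have h2 : 0 ≤ (N + k : ℝ) ^ (2 - q) := by positivity
    have h3 : ((N : ℝ) ^ (2 - q) - (N + k : ℝ) ^ (2 - q)) / (q - 2) ≤ (N : ℝ) ^ (2 - q) / (q - 2) := by
      apply div_le_div_of_nonneg_right <;> linarith
    have h4 : (N : ℝ) ^ (2 - q) * ((q - 1) / (q - 2))
        = (N : ℝ) ^ (2 - q) + (N : ℝ) ^ (2 - q) / (q - 2) := by
      have : q - 2 ≠ 0 := by linarith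
      field_simp; ring
    linarith
  · rw [Finset.Ico_eq_empty_of_le h, Finset.sum_empty]
    have : 0 ≤ (q - 1) / (q - 2) := div_nonneg (by linarith) (by linarith)
    positivity

theorem sum_Ico_exp_le {t : ℝ} (ht : 0 < t) (N B : ℕ) :
    ∑ n ∈ Finset.Ico N B, Real.exp (-(n * t)) ≤ Real.exp (-(N * t)) / (1 - Real.exp (-t)) := by
  have e : ∀ n : ℕ, Real.exp (-(n * t)) = Real.exp (-t) ^ n := by
    intro n; rw [← Real.exp_nat_mul]; congr 1; ring
  simp only [e]
  exact geom_sum_Ico_le_of_lt_one (Real.exp_pos _).le (Real.exp_lt_one_iff.2 (by linarith))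

/-- The bound on the expected number of observations of a suboptimal alternative. -/
noncomputable def sizeBound (q M b : ℝ) (N : ℕ) : ℝ :=
  N + tailRatio * (momentC₁ q M * b ^ (-q) * (N : ℝ) ^ (-q + 2))
    + Real.exp (-(N * momentC₂ q M * b ^ 2)) / (1 - Real.exp (-(momentC₂ q M * b ^ 2)))

/-- Strictness comes from `1 + e < 3.74`. Admissibility allows equality `2 C = c`, so this is where
the margin for Chebyshev's inequality originates. -/
theorem sizeBound_lt_momentC {q M b : ℝ} (hq : 3 ≤ q) (hM : 0 < M) (hb : 0 < b) {N : ℕ}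
    (hN : 1 ≤ N) : sizeBound q M b N < momentC q M b N := by
  have h1 : 0 < momentA₁ q M := momentA₁_pos (by linarith) hM
  have h2 : 0 < (q - 1) / (q - 2) := div_pos (by linarith) (by linarith)
  have hN0 : (0 : ℝ) < N := by exact_mod_cast hN
  have h3 : 0 < momentC₁ q M * b ^ (-q) * (N : ℝ) ^ (-q + 2) := by
    unfold momentC₁; positivity
  have := tailRatio_lt_one
  unfold sizeBound momentC
  nlinarith

theorem sum_Ico_tailBound_le {q M b : ℝ} (hq : 3 ≤ q) (hM : 0 < M) (hb : 0 < b) {N : ℕ}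
    (hN : 1 ≤ N) (B : ℕ) : N + ∑ n ∈ Finset.Ico N B, tailBound q M b n ≤ sizeBound q M b N := by
  have hc := momentC₂_pos (show 0 < q by linarith) hM
  have hA := momentA₁_pos (show 0 < q by linarith) hM
  have hr := tailRatio_pos
  have h1 := sum_Ico_rpow_le hq hN B
  have h2 := sum_Ico_exp_le (t := momentC₂ q M * b ^ 2) (by positivity) N B
  unfold tailBound sizeBound
  rw [Finset.sum_add_distrib, ← Finset.mul_sum]
  simp only [← mul_assoc] at h2 ⊢
  have h3 := mul_le_mul_of_nonneg_left h1
    (show 0 ≤ tailRatio * momentA₁ q M * b ^ (-q) by positivity)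
  have e : tailRatio * momentA₁ q M * b ^ (-q) * ((N : ℝ) ^ (-q + 2) * ((q - 1) / (q - 2)))
      = tailRatio * momentC₁ q M * b ^ (-q) * (N : ℝ) ^ (-q + 2) := by
    unfold momentC₁; ring
  rw [e] at h3
  linarith

/-- The polynomial part is of order `n ^ (2 - q)`, which is where `q > 3` is needed. -/
theorem summable_mul_tailBound {q M b : ℝ} (hq : 3 < q) (hM : 0 < M) (hb : 0 < b) :
    Summable fun n : ℕ => (2 * n + 1 : ℝ) * tailBound q M b n := by
  have hc := momentC₂_pos (show 0 < q by linarith) hM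
  set t := momentC₂ q M * b ^ 2 with ht
  have ht0 : 0 < t := by positivity
  have e : ∀ n : ℕ, Real.exp (-(n * momentC₂ q M * b ^ 2)) = Real.exp (-t) ^ n := by
    intro n; rw [← Real.exp_nat_mul]; congr 1; rw [ht]; ring
  have hlt : Real.exp (-t) < 1 := Real.exp_lt_one_iff.2 (by linarith)
  have hnorm : ‖Real.exp (-t)‖ < 1 := by rwa [Real.norm_of_nonneg (Real.exp_pos _).le]
  have s1 : Summable fun n : ℕ => (n : ℝ) ^ (2 - q) := Real.summable_nat_rpow.2 (by linarith)
  have s2 : Summable fun n : ℕ => (n : ℝ) ^ (1 - q) := Real.summable_nat_rpow.2 (by linarith)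
  have s3 := summable_pow_mul_geometric_of_norm_lt_one 1 hnorm
  have s4 := summable_geometric_of_norm_lt_one hnorm
  set K := tailRatio * momentA₁ q M * b ^ (-q) with hK
  refine (((s1.mul_left (2 * K)).add (s2.mul_left K)).add ((s3.mul_left 2).add s4)).congr ?_
  intro n
  rw [tailBound, e, ← hK]
  have : (n : ℝ) * (n : ℝ) ^ (1 - q) = (n : ℝ) ^ (2 - q) := by
    rcases Nat.eq_zero_or_pos n with rfl | hn
    · simp [Real.zero_rpow (show 2 - q ≠ 0 by linarith)]
    · rw [show 2 - q = 1 + (1 - q) by ring, Real.rpow_add (by exact_mod_cast hn), Real.rpow_one]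
  rw [← this]; ring

/-! ### Run length of a single alternative -/

/-- The observation sequences on which the UCB value is at least `a` up to the sample size `n`. -/
def aboveSet (f : ℕ → ℝ) (a : ℝ) (n : ℕ) : Set (ℕ → ℝ) :=
  {x | ∀ m, 1 ≤ m → m ≤ n → a ≤ ucb f x m}

theorem measurableSet_aboveSet (f : ℕ → ℝ) (a : ℝ) (n : ℕ) : MeasurableSet (aboveSet f a n) := by
  have : aboveSet f a n = ⋂ m, ⋂ (_ : 1 ≤ m), ⋂ (_ : m ≤ n), {x | a ≤ ucb f x m} := by
    ext x; simp [aboveSet]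
  rw [this]
  exact MeasurableSet.iInter fun m => MeasurableSet.iInter fun _ => MeasurableSet.iInter fun _ =>
    measurableSet_le measurable_const (measurable_ucb f m)

/-- The number of sample sizes `n < B` up to which the UCB value has been at least `a`. -/
noncomputable def runLength (f : ℕ → ℝ) (a : ℝ) (B : ℕ) (x : ℕ → ℝ) : ℝ :=
  ∑ n ∈ Finset.range B, (aboveSet f a n).indicator (fun _ => (1 : ℝ)) x

theorem measurable_runLength (f : ℕ → ℝ) (a : ℝ) (B : ℕ) : Measurable (runLength f a B) :=
  Finset.measurable_sum _ fun n _ => measurable_const.indicator (measurableSet_aboveSet f a n)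

theorem indicator_mem_Icc (s : Set (ℕ → ℝ)) (x : ℕ → ℝ) :
    s.indicator (fun _ => (1 : ℝ)) x ∈ Set.Icc (0 : ℝ) 1 := by
  unfold Set.indicator; split_ifs <;> simp

theorem runLength_nonneg (f : ℕ → ℝ) (a : ℝ) (B : ℕ) (x : ℕ → ℝ) : 0 ≤ runLength f a B x :=
  Finset.sum_nonneg fun _ _ => (indicator_mem_Icc _ _).1

theorem runLength_le (f : ℕ → ℝ) (a : ℝ) (B : ℕ) (x : ℕ → ℝ) : runLength f a B x ≤ B := by
  unfold runLength
  calc _ ≤ ∑ n ∈ Finset.range B, (1 : ℝ) := Finset.sum_le_sum fun _ _ => (indicator_mem_Icc _ _).2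
    _ = B := by simp

/-- Pathwise version of `E R² = ∑ (2n + 1) Pr{R > n}`: an increment `χ ∈ [0, 1]` added to `R ≤ n`
raises the square by at most `(2n + 1) χ`. -/
theorem runLength_sq_le (f : ℕ → ℝ) (a : ℝ) (B : ℕ) (x : ℕ → ℝ) :
    runLength f a B x ^ 2
      ≤ ∑ n ∈ Finset.range B, (2 * n + 1 : ℝ) * (aboveSet f a n).indicator (fun _ => (1 : ℝ)) x := by
  induction B with
  | zero => simp [runLength]
  | succ B ih =>
    have h1 : runLength f a (B + 1) x
        = runLength f a B x + (aboveSet f a B).indicator (fun _ => (1 : ℝ)) x := by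
      unfold runLength; rw [Finset.sum_range_succ]
    rw [Finset.sum_range_succ, h1]
    have h2 := runLength_le f a B x
    obtain ⟨h3, h4⟩ := indicator_mem_Icc (aboveSet f a B) x
    nlinarith

/-- The sizes `0, …, n - 1` each contribute 1; size 0, where the condition is vacuous, accounts for
the initial observation. -/
theorem le_runLength {f : ℕ → ℝ} {a : ℝ} {B n : ℕ} {x : ℕ → ℝ} (hn : n ≤ B)
    (h : ∀ m, 1 ≤ m → m < n → a ≤ ucb f x m) : (n : ℝ) ≤ runLength f a B x := by
  calc (n : ℝ) = ∑ m ∈ Finset.range n, (aboveSet f a m).indicator (fun _ => (1 : ℝ)) x := by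
        rw [Finset.sum_congr rfl (g := fun _ => (1 : ℝ))]
        · simp
        · intro m hm
          rw [Finset.mem_range] at hm
          have hx : x ∈ aboveSet f a m := fun l h1 h2 => h l h1 (h2.trans_lt hm)
          simp [hx]
    _ ≤ _ := by
      apply Finset.sum_le_sum_of_subset_of_nonneg
      · exact Finset.range_mono hn
      · exact fun _ _ _ => (indicator_mem_Icc _ _).1

theorem integral_indicator_aboveSet {ν : Measure ℝ} (f : ℕ → ℝ) (a : ℝ) (n : ℕ) :
    ∫ x, (aboveSet f a n).indicator (fun _ => (1 : ℝ)) x ∂(seqLaw ν)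
      = (seqLaw ν).real (aboveSet f a n) := by
  rw [integral_indicator (measurableSet_aboveSet f a n)]; simp

section OneArm
variable {ν : Measure ℝ} [IsProbabilityMeasure ν]

theorem integrable_indicator_aboveSet (f : ℕ → ℝ) (a : ℝ) (n : ℕ) :
    Integrable ((aboveSet f a n).indicator fun _ => (1 : ℝ)) (seqLaw ν) :=
  (integrable_const 1).indicator (measurableSet_aboveSet f a n)

variable {q M b a : ℝ} {f : ℕ → ℝ} {N : ℕ}

theorem measureReal_aboveSet_le (hq : 3 ≤ q) (hM : 0 < M)
    (hi : Integrable (fun x : ℝ => |x| ^ q) ν) (hle : ∫ x, |x| ^ q ∂ν ≤ M) (hb : 0 < b)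
    (hN : IsThreshold f b N) (ha : (∫ x, x ∂ν) + 2 * b ≤ a) {n : ℕ} (hn : N ≤ n) :
    (seqLaw ν).real (aboveSet f a n) ≤ tailBound q M b n := by
  have hn1 : 1 ≤ n := hN.1.trans hn
  refine le_trans (measureReal_mono ?_) (measureReal_sampleMean_ge_le hq hM hi hle hb hn1)
  intro x hx
  have h1 := hx n hn1 le_rfl
  have h2 := hN.2 n hn
  unfold ucb at h1
  simp only [Set.mem_ofPred_eq]
  linarith

/-- Used with weight 1 for the mean and `2n + 1` for the second moment. Below `N` the probability is
bounded by 1, which produces the summand `n` of `C(b; n)`. -/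
theorem sum_weight_mul_measureReal_le (hq : 3 ≤ q) (hM : 0 < M)
    (hi : Integrable (fun x : ℝ => |x| ^ q) ν) (hle : ∫ x, |x| ^ q ∂ν ≤ M) (hb : 0 < b)
    (hN : IsThreshold f b N) (ha : (∫ x, x ∂ν) + 2 * b ≤ a) {w : ℕ → ℝ} (hw : ∀ n, 0 ≤ w n)
    (B : ℕ) :
    ∑ n ∈ Finset.range B, w n * (seqLaw ν).real (aboveSet f a n)
      ≤ ∑ n ∈ Finset.range N, w n + ∑ n ∈ Finset.Ico N B, w n * tailBound q M b n := by
  have h1 : ∀ n ∈ Finset.range B, w n * (seqLaw ν).real (aboveSet f a n)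
      ≤ if n < N then w n else w n * tailBound q M b n := by
    intro n _
    split_ifs with h
    · exact mul_le_of_le_one_right (hw n) measureReal_le_one
    · exact mul_le_mul_of_nonneg_left
        (measureReal_aboveSet_le hq hM hi hle hb hN ha (not_lt.1 h)) (hw n)
  refine (Finset.sum_le_sum h1).trans ?_
  rw [Finset.sum_ite]
  apply add_le_add
  · apply Finset.sum_le_sum_of_subset_of_nonneg
    · intro n hn
      simp only [Finset.mem_filter, Finset.mem_range] at hn ⊢
      exact hn.2
    · exact fun n _ _ => hw n
  · apply le_of_eq
    congr 1
    ext n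
    simp only [Finset.mem_filter, Finset.mem_range, Finset.mem_Ico, not_lt]
    tauto

theorem integral_runLength_le (hq : 3 ≤ q) (hM : 0 < M)
    (hi : Integrable (fun x : ℝ => |x| ^ q) ν) (hle : ∫ x, |x| ^ q ∂ν ≤ M) (hb : 0 < b)
    (hN : IsThreshold f b N) (ha : (∫ x, x ∂ν) + 2 * b ≤ a) (B : ℕ) :
    ∫ x, runLength f a B x ∂(seqLaw ν) ≤ sizeBound q M b N := by
  unfold runLength
  rw [integral_finsetSum _ fun n _ => integrable_indicator_aboveSet f a n]
  simp only [integral_indicator_aboveSet]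
  have h := sum_weight_mul_measureReal_le hq hM hi hle hb hN ha (w := fun _ => 1)
    (fun _ => zero_le_one) B
  simp only [one_mul, Finset.sum_const, Finset.card_range, nsmul_eq_mul, mul_one] at h
  exact h.trans (sum_Ico_tailBound_le hq hM hb hN.1 B)

/-- The bound on the second moment of the number of observations of a suboptimal alternative. -/
noncomputable def sizeSqBound (q M b : ℝ) (N : ℕ) : ℝ :=
  ∑ n ∈ Finset.range N, (2 * n + 1 : ℝ) + ∑' n : ℕ, (2 * n + 1 : ℝ) * tailBound q M b n

theorem integral_runLength_sq_le (hq : 3 < q) (hM : 0 < M)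
    (hi : Integrable (fun x : ℝ => |x| ^ q) ν) (hle : ∫ x, |x| ^ q ∂ν ≤ M) (hb : 0 < b)
    (hN : IsThreshold f b N) (ha : (∫ x, x ∂ν) + 2 * b ≤ a) (B : ℕ) :
    ∫ x, runLength f a B x ^ 2 ∂(seqLaw ν) ≤ sizeSqBound q M b N := by
  have hI : Integrable (fun x => runLength f a B x ^ 2) (seqLaw ν) := by
    refine Integrable.mono' (integrable_const ((B : ℝ) ^ 2))
      ((measurable_runLength f a B).pow_const 2).aestronglyMeasurable (ae_of_all _ fun x => ?_)
    rw [Real.norm_of_nonneg (sq_nonneg _)]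
    have := runLength_nonneg f a B x
    have := runLength_le f a B x
    gcongr
  have hterm : ∀ n ∈ Finset.range B, Integrable (fun x => (2 * n + 1 : ℝ)
      * (aboveSet f a n).indicator (fun _ => (1 : ℝ)) x) (seqLaw ν) :=
    fun n _ => (integrable_indicator_aboveSet f a n).const_mul _
  refine (integral_mono hI (integrable_finsetSum _ hterm) (runLength_sq_le f a B)).trans ?_
  rw [integral_finsetSum _ hterm]
  simp only [integral_const_mul, integral_indicator_aboveSet]
  refine (sum_weight_mul_measureReal_le hq.le hM hi hle hb hN ha
    (w := fun n => (2 * n + 1 : ℝ)) (fun n => by positivity) B).trans ?_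
  unfold sizeSqBound
  gcongr
  exact (summable_mul_tailBound hq hM hb).sum_le_tsum _ fun n _ =>
    mul_nonneg (by positivity) (tailBound_nonneg (by linarith) hM hb n)

/-! ### The minimum of the UCB process of the best alternative -/

theorem ae_tendsto_sampleMean (hint : Integrable (fun x : ℝ => x) ν) :
    ∀ᵐ x ∂(seqLaw ν), Tendsto (sampleMean x) atTop (𝓝 (∫ y, y ∂ν)) := by
  have h := strong_law_ae_real (μ := seqLaw ν) (fun j (x : ℕ → ℝ) => x j)
    ((integrable_coord_iff measurable_id 0).2 hint)
    (fun i j hij => (iIndepFun_coord measurable_id).indepFun hij)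
    (fun j => identDistrib_coord measurable_id j 0)
  have e : ∫ x : ℕ → ℝ, x 0 ∂(seqLaw ν) = ∫ y, y ∂ν := integral_coord measurable_id 0
  rw [e] at h
  exact h

theorem ae_tendsto_ucb (hf : IsBonus f) (hint : Integrable (fun x : ℝ => x) ν) :
    ∀ᵐ x ∂(seqLaw ν), Tendsto (ucb f x) atTop (𝓝 (∫ y, y ∂ν)) := by
  filter_upwards [ae_tendsto_sampleMean hint] with x hx
  have h := hx.add hf.tendsto_zero
  rwa [add_zero] at h

theorem measurePreserving_shift (N : ℕ) :
    MeasurePreserving (fun (x : ℕ → ℝ) j => x (N + j)) (seqLaw ν) (seqLaw ν) :=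
  ⟨by fun_prop, Measure.map_infinitePi_infinitePi_of_inj (P := fun _ : ℕ => ν)
    (add_right_injective N)⟩

/-- With positive probability a random walk with positive drift never becomes negative. -/
theorem measure_forall_sum_nonneg_pos (hint : Integrable (fun x : ℝ => x) ν) {g : ℝ}
    (hg : (∫ y, y ∂ν) > g) :
    0 < seqLaw ν {x | ∀ n, 0 ≤ ∑ j ∈ Finset.range n, (x j - g)} := by
  rw [pos_iff_ne_zero]
  intro h0
  -- By shift invariance, if the event were null, the walk restarted at any time would almost surely
  -- become negative.
  have hnull : ∀ N : ℕ, ∀ᵐ x ∂(seqLaw ν),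
      ¬ ∀ n, 0 ≤ ∑ j ∈ Finset.range n, (x (N + j) - g) := by
    intro N
    have := (measurePreserving_shift (ν := ν) N).quasiMeasurePreserving.preimage_null h0
    rw [ae_iff]
    simpa using this
  have hfalse : ∀ᵐ x ∂(seqLaw ν), False := by
    filter_upwards [ae_all_iff.2 hnull, ae_tendsto_sampleMean hint] with x hx hlim
    have htop : Tendsto (fun n : ℕ => ∑ j ∈ Finset.range n, (x j - g)) atTop atTop := by
      have h1 : Tendsto (fun n : ℕ => (n : ℝ) * (sampleMean x n - g)) atTop atTop :=
        tendsto_natCast_atTop_atTop.atTop_mul_pos (sub_pos.2 hg) (hlim.sub_const g)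
      refine h1.congr fun n => ?_
      rcases Nat.eq_zero_or_pos n with rfl | hn
      · simp
      · have : (n : ℝ) ≠ 0 := by positivity
        simp only [sampleMean, Finset.sum_sub_distrib, Finset.sum_const, Finset.card_range,
          nsmul_eq_mul]
        field_simp
    -- A walk tending to infinity attains its minimum at some `N`, and from there it never goes
    -- lower: a contradiction.
    rw [← Nat.cofinite_eq_atTop] at htop
    obtain ⟨N, hN⟩ := htop.exists_forall_le
    refine hx N fun n => ?_
    have := hN (N + n)
    rw [Finset.sum_range_add] at this
    linarith
  exact IsProbabilityMeasure.ne_zero (seqLaw ν) (by simpa using hfalse)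

theorem coe_le_ucbInf_iff {x : ℕ → ℝ} {a : ℝ} :
    (a : EReal) ≤ ucbInf f x ↔ ∀ n, 1 ≤ n → a ≤ ucb f x n := by
  simp [ucbInf, le_iInf_iff]

theorem measurableSet_le_ucbInf (f : ℕ → ℝ) (a : ℝ) :
    MeasurableSet {x : ℕ → ℝ | (a : EReal) ≤ ucbInf f x} := by
  simp only [coe_le_ucbInf_iff, Set.ofPred_forall]
  exact MeasurableSet.iInter fun m => MeasurableSet.iInter fun _ =>
    measurableSet_le measurable_const (measurable_ucb f m)

theorem measureReal_le_ucbInf_pos (hf : IsBonus f) (hint : Integrable (fun x : ℝ => x) ν) {g : ℝ}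
    (hg : 0 < g) :
    0 < (seqLaw ν).real {x | (((∫ y, y ∂ν) - g : ℝ) : EReal) ≤ ucbInf f x} := by
  have h := measure_forall_sum_nonneg_pos hint (g := (∫ y, y ∂ν) - g) (by linarith)
  rw [measureReal_def, ENNReal.toReal_pos_iff]
  refine ⟨h.trans_le (measure_mono fun x hx => ?_), measure_lt_top _ _⟩
  simp only [Set.mem_ofPred_eq, coe_le_ucbInf_iff] at hx ⊢
  intro n hn
  have h1 := hx n
  have h2 := hf.nonneg n hn
  have hn0 : (0 : ℝ) < n := by exact_mod_cast hn
  simp only [Finset.sum_sub_distrib, Finset.sum_const, Finset.card_range, nsmul_eq_mul] at h1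
  have h3 : (∫ y, y ∂ν) - g ≤ sampleMean x n := by
    rw [sampleMean, le_div_iff₀ hn0]; linarith
  unfold ucb
  linarith

/-- The first observation is independent of the sum of the others, so by Fubini its lack of atoms
passes to the sum. -/
theorem ae_ucb_ne (hν : ∀ y, ν {y} = 0) {n : ℕ} (hn : 1 ≤ n) (a : ℝ) :
    ∀ᵐ x ∂(seqLaw ν), ucb f x n ≠ a := by
  have hn0 : (n : ℝ) ≠ 0 := by positivity
  have hind : IndepFun (∑ j ∈ Finset.Ico 1 n, fun x : ℕ → ℝ => x j) (fun x => x 0) (seqLaw ν) :=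
    (iIndepFun_coord measurable_id).indepFun_finsetSum_of_notMem
      (fun j => measurable_pi_apply j) (by simp)
  have hm : Measurable (∑ j ∈ Finset.Ico 1 n, fun x : ℕ → ℝ => x j) := by fun_prop
  have hmap := (indepFun_iff_map_prod_eq_prod_map_map hm.aemeasurable
    (measurable_pi_apply 0).aemeasurable).1 hind
  rw [(hasLaw_coord (ν := ν) 0).map_eq] at hmap
  set t : ℝ := n * (a - f n) with ht
  have hS : MeasurableSet {p : ℝ × ℝ | p.1 + p.2 = t} :=
    measurableSet_eq_fun (by fun_prop) (by fun_prop)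
  have hzero : (((seqLaw ν).map (∑ j ∈ Finset.Ico 1 n, fun x : ℕ → ℝ => x j)).prod ν)
      {p : ℝ × ℝ | p.1 + p.2 = t} = 0 := by
    rw [Measure.measure_prod_null hS]
    refine ae_of_all _ fun r => ?_
    have : Prod.mk r ⁻¹' {p : ℝ × ℝ | p.1 + p.2 = t} = {t - r} := by
      ext y
      simp only [Set.mem_preimage, Set.mem_ofPred_eq, Set.mem_singleton_iff]
      constructor <;> intro h <;> linarith
    simp only [this, hν, Pi.zero_apply]
  rw [← hmap, Measure.map_apply (by fun_prop) hS] at hzero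
  rw [ae_iff]
  refine measure_mono_null (fun x hx => ?_) hzero
  simp only [ne_eq, not_not, Set.mem_ofPred_eq, Set.mem_preimage, Finset.sum_apply] at hx ⊢
  unfold ucb sampleMean at hx
  have h1 : ∑ j ∈ Finset.range n, x j = t := by
    rw [ht, ← hx]; field_simp; ring
  rw [← h1, Finset.range_eq_Ico, Finset.sum_eq_sum_Ico_succ_bot hn]
  simp [add_comm]

/-- Left-continuity of `g ↦ Pr {U^* ≥ μ - g}` at `γ₀ > 0`. -/
theorem measureReal_le_ucbInf_le_of_tendsto (hf : IsBonus f) (hint : Integrable (fun x : ℝ => x) ν)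
    (hν : ∀ y, ν {y} = 0) {γ₀ L : ℝ} (hγ₀ : 0 < γ₀) {g : ℕ → ℝ} (hg : Monotone g)
    (hlim : Tendsto g atTop (𝓝 γ₀))
    (hL : ∀ j, (seqLaw ν).real {x | (((∫ y, y ∂ν) - g j : ℝ) : EReal) ≤ ucbInf f x} ≤ L) :
    (seqLaw ν).real {x | (((∫ y, y ∂ν) - γ₀ : ℝ) : EReal) ≤ ucbInf f x} ≤ L := by
  set μ := ∫ y, y ∂ν with hμ
  have hmono : Monotone fun j => {x : ℕ → ℝ | ((μ - g j : ℝ) : EReal) ≤ ucbInf f x} := by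
    intro i j hij x hx
    simp only [Set.mem_ofPred_eq] at hx ⊢
    refine le_trans ?_ hx
    exact_mod_cast sub_le_sub_left (hg hij) μ
  have htend := tendsto_measure_iUnion_atTop (μ := seqLaw ν) hmono
  have hreal : (seqLaw ν).real (⋃ j, {x : ℕ → ℝ | ((μ - g j : ℝ) : EReal) ≤ ucbInf f x}) ≤ L :=
    le_of_tendsto' ((ENNReal.tendsto_toReal (measure_ne_top _ _)).comp htend) hL
  refine le_trans ?_ hreal
  rw [measureReal_def, measureReal_def]
  refine ENNReal.toReal_mono (measure_ne_top _ _) (measure_mono_ae ?_)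
  have hne : ∀ᵐ x ∂(seqLaw ν), ∀ n, 1 ≤ n → ucb f x n ≠ μ - γ₀ := by
    rw [ae_all_iff]; intro n
    rw [ae_all_iff]; intro hn
    exact ae_ucb_ne hν hn _
  filter_upwards [hne, ae_tendsto_ucb hf hint] with x h1 h2 hx
  have hx' : ∀ n, 1 ≤ n → μ - γ₀ ≤ ucb f x n := coe_le_ucbInf_iff.1 hx
  obtain ⟨N, hN⟩ := (h2.eventually (lt_mem_nhds (show μ - γ₀ / 2 < μ by linarith))).exists_forall_of_atTop
  obtain ⟨g', hg', hall⟩ : ∃ g' < γ₀, ∀ n, 1 ≤ n → μ - g' ≤ ucb f x n := by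
    -- From `N` on the values exceed `μ - γ₀ / 2`; the finitely many earlier ones exceed `μ - γ₀`
    -- strictly, so some `g' < γ₀` serves all sizes.
    have hfin : ∀ K : ℕ, ∃ g' < γ₀, ∀ n, 1 ≤ n → n < K → μ - g' ≤ ucb f x n := by
      intro K
      induction K with
      | zero => exact ⟨γ₀ / 2, by linarith, by simp⟩
      | succ K ih =>
        obtain ⟨g', h3, h4⟩ := ih
        by_cases hK : 1 ≤ K
        · have h5 : μ - γ₀ < ucb f x K := lt_of_le_of_ne (hx' K hK) (h1 K hK).symm
          refine ⟨max g' (μ - ucb f x K), max_lt h3 (by linarith), fun n hn1 hn2 => ?_⟩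
          rcases Nat.lt_succ_iff_lt_or_eq.1 hn2 with h6 | rfl
          · linarith [h4 n hn1 h6, le_max_left g' (μ - ucb f x K)]
          · linarith [le_max_right g' (μ - ucb f x n)]
        · exact ⟨g', h3, fun n hn1 hn2 => absurd hn2 (by omega)⟩
    obtain ⟨g', h3, h4⟩ := hfin N
    refine ⟨max g' (γ₀ / 2), max_lt h3 (by linarith), fun n hn => ?_⟩
    rcases lt_or_ge n N with h5 | h5
    · linarith [h4 n hn h5, le_max_left g' (γ₀ / 2)]
    · linarith [hN n h5, le_max_right g' (γ₀ / 2)]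
  obtain ⟨j, hj⟩ := (hlim.eventually (lt_mem_nhds hg')).exists
  refine Set.mem_iUnion.2 ⟨j, ?_⟩
  simp only [Set.mem_ofPred_eq, coe_le_ucbInf_iff]
  intro n hn
  linarith [hall n hn]

end OneArm

/-! ### Pathwise analysis of the algorithm -/

section Algorithm
variable {ι : Type*} [Fintype ι] [DecidableEq ι] {f : ℕ → ℝ} {x : ι → ℕ → ℝ} {B : ℕ}

theorem MetaUCBReachable.one_le {n : ι → ℕ} (h : MetaUCBReachable f x B n) (i : ι) : 1 ≤ n i := by
  induction h with
  | init => exact le_rfl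
  | step n s hn hB hs ih =>
    rcases eq_or_ne i s with rfl | hi
    · simp
    · simpa [hi] using ih

theorem MetaUCBReachable.le_budget {n : ι → ℕ} (h : MetaUCBReachable f x B n) (hB : 1 ≤ B) (i : ι) :
    n i ≤ B := by
  induction h with
  | init => exact hB
  | step n s hn hlt hs ih =>
    rcases eq_or_ne i s with rfl | hi
    · have := Finset.single_le_sum (f := n) (fun j _ => Nat.zero_le _) (Finset.mem_univ i)
      simp only [Function.update_self]
      omega
    · simpa [hi] using ih

/-- An alternative is sampled again only while its UCB value is at least the minimum of the UCB
values of any other alternative. -/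
theorem MetaUCBReachable.le_ucb {n : ι → ℕ} (h : MetaUCBReachable f x B n) {i₀ : ι} {a : ℝ}
    (ha : ∀ m, 1 ≤ m → a ≤ ucb f (x i₀) m) (i : ι) :
    ∀ m, 1 ≤ m → m < n i → a ≤ ucb f (x i) m := by
  induction h with
  | init => exact fun m h1 h2 => absurd (h1.trans_lt h2) (lt_irrefl 1)
  | step n s hn hlt hs ih =>
    intro m h1 h2
    rcases eq_or_ne i s with rfl | hi
    · simp only [Function.update_self] at h2
      rcases Nat.lt_succ_iff_lt_or_eq.1 h2 with h3 | rfl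
      · exact ih m h1 h3
      · exact (ha _ (hn.one_le i₀)).trans (hs i₀)
    · rw [Function.update_of_ne hi] at h2
      exact ih m h1 h2

/-- The other alternatives together hold less than half of the budget, hence `i₀` holds more than
half and more than any single competitor. -/
theorem MetaUCBOutputs.eq_of_sum_runLength_lt {b : ι} (h : MetaUCBOutputs f x B b) {i₀ : ι} {a : ℝ}
    (ha : ∀ m, 1 ≤ m → a ≤ ucb f (x i₀) m)
    (hB : 2 * ∑ i ∈ Finset.univ.erase i₀, runLength f a B (x i) < B) : b = i₀ := by
  obtain ⟨n, hn, hend, hmax⟩ := h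
  have hnonneg : ∀ i ∈ Finset.univ.erase i₀, 0 ≤ runLength f a B (x i) :=
    fun i _ => runLength_nonneg f a B (x i)
  have hB1 : 1 ≤ B := by
    have h1 := Finset.sum_nonneg hnonneg
    have h2 : (0 : ℝ) < B := by linarith
    exact_mod_cast h2
  have hle : ∀ i, (n i : ℝ) ≤ runLength f a B (x i) := fun i =>
    le_runLength (hn.le_budget hB1 i) (hn.le_ucb ha i)
  have hsum : (B : ℝ) ≤ n i₀ + ∑ i ∈ Finset.univ.erase i₀, (n i : ℝ) := by
    rw [Finset.add_sum_erase _ (fun i => (n i : ℝ)) (Finset.mem_univ i₀)]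
    exact_mod_cast hend
  have hsum2 : ∑ i ∈ Finset.univ.erase i₀, (n i : ℝ)
      ≤ ∑ i ∈ Finset.univ.erase i₀, runLength f a B (x i) := Finset.sum_le_sum fun i _ => hle i
  by_contra hb
  have h1 := Finset.single_le_sum hnonneg (Finset.mem_erase.2 ⟨hb, Finset.mem_univ b⟩)
  have h2 : (n i₀ : ℝ) ≤ n b := by exact_mod_cast hmax i₀
  linarith [hle b]

end Algorithm

/-! ### Many independent alternatives -/

section Sampling
variable {Ω : Type*} [MeasurableSpace Ω] {P : Measure Ω} [IsProbabilityMeasure P]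
  {ι : Type*} {ν : ι → Measure ℝ} {X : ι → ℕ → Ω → ℝ}

theorem IsSampling.isProbabilityMeasure (h : IsSampling P ν X) (i : ι) :
    IsProbabilityMeasure (ν i) := (h.hasLaw i 0).isProbabilityMeasure_iff.1 inferInstance

variable [Countable ι]

/-- Currying the product law over pairs `(i, j)` groups the observations by alternative, giving
independent whole sequences. -/
theorem IsSampling.hasLaw_curry (h : IsSampling P ν X) :
    HasLaw (fun ω i j => X i j ω) (Measure.infinitePi fun i => seqLaw (ν i)) P := by
  have := h.isProbabilityMeasure
  have h1 : HasLaw (fun ω (p : ι × ℕ) => X p.1 p.2 ω)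
      (Measure.infinitePi fun p : ι × ℕ => ν p.1) P :=
    h.indep.hasLaw_infinitePi (fun p => h.hasLaw p.1 p.2)
      (aemeasurable_pi_iff.2 fun p => (h.hasLaw p.1 p.2).aemeasurable)
  have h2 : HasLaw (MeasurableEquiv.curry ι ℕ ℝ) (Measure.infinitePi fun i => seqLaw (ν i))
      (Measure.infinitePi fun p : ι × ℕ => ν p.1) :=
    ⟨(MeasurableEquiv.curry ι ℕ ℝ).measurable.aemeasurable,
      Measure.infinitePi_map_curry (fun i (_ : ℕ) => ν i)⟩
  exact h2.comp h1

theorem IsSampling.hasLaw_seq (h : IsSampling P ν X) (i : ι) :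
    HasLaw (fun ω j => X i j ω) (seqLaw (ν i)) P := by
  have := h.isProbabilityMeasure
  have h1 : HasLaw (fun x : ι → ℕ → ℝ => x i) (seqLaw (ν i))
      (Measure.infinitePi fun i => seqLaw (ν i)) :=
    ⟨(measurable_pi_apply i).aemeasurable, Measure.infinitePi_map_eval _ i⟩
  exact h1.comp h.hasLaw_curry

theorem IsSampling.iIndepFun_seq (h : IsSampling P ν X) :
    iIndepFun (fun i ω j => X i j ω) P := by
  have := h.isProbabilityMeasure
  exact (iIndepFun_iff_hasLaw_Pi_infinitePi h.hasLaw_seq h.hasLaw_curry.aemeasurable).2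
    h.hasLaw_curry

theorem IsSampling.measureReal_le_ucbInf (h : IsSampling P ν X) (i : ι) (f : ℕ → ℝ) (a : ℝ) :
    P.real {ω | (a : EReal) ≤ ucbInf f (fun j => X i j ω)}
      = (seqLaw (ν i)).real {x | (a : EReal) ≤ ucbInf f x} :=
  (h.hasLaw_seq i).measureReal_eq (measurableSet_le_ucbInf f a)

/-- Chebyshev's inequality for the total run length of a set of alternatives. -/
theorem IsSampling.measureReal_sum_runLength_ge_le (h : IsSampling P ν X) {f : ℕ → ℝ} {a D V η : ℝ}
    {B : ℕ} {s : Finset ι} (hs : s.Nonempty) (hη : 0 < η)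
    (hD : ∀ i ∈ s, ∫ x, runLength f a B x ∂(seqLaw (ν i)) ≤ D)
    (hV : ∀ i ∈ s, ∫ x, runLength f a B x ^ 2 ∂(seqLaw (ν i)) ≤ V) :
    P.real {ω | s.card * (D + η) ≤ ∑ i ∈ s, runLength f a B (fun j => X i j ω)}
      ≤ V / (s.card * η ^ 2) := by
  have hcard : (0 : ℝ) < s.card := by exact_mod_cast hs.card_pos
  have hmr := measurable_runLength f a B
  set W : ι → Ω → ℝ := fun i ω => runLength f a B (fun j => X i j ω) with hW
  have hWm : ∀ i, AEMeasurable (W i) P := fun i => hmr.comp_aemeasurable (h.hasLaw_seq i).aemeasurable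
  have hWind : iIndepFun W P := h.iIndepFun_seq.comp (fun _ => runLength f a B) fun _ => hmr
  have hWLp : ∀ i, MemLp (W i) 2 P := fun i =>
    MemLp.of_bound (hWm i).aestronglyMeasurable B (ae_of_all _ fun ω => by
      rw [Real.norm_of_nonneg (runLength_nonneg _ _ _ _)]
      exact runLength_le f a B _)
  have hWmean : ∀ i ∈ s, ∫ ω, W i ω ∂P ≤ D := fun i hi =>
    ((h.hasLaw_seq i).integral_comp hmr.aestronglyMeasurable).trans_le (hD i hi)
  have hWvar : ∀ i ∈ s, variance (W i) P ≤ V := fun i hi =>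
    (variance_le_expectation_sq (hWm i).aestronglyMeasurable).trans
      (((h.hasLaw_seq i).integral_comp (hmr.pow_const 2).aestronglyMeasurable).trans_le (hV i hi))
  have hsumLp : MemLp (∑ i ∈ s, W i) 2 P := memLp_finsetSum' s fun i _ => hWLp i
  have hvar : variance (∑ i ∈ s, W i) P ≤ s.card * V := by
    rw [IndepFun.variance_sum (fun i _ => hWLp i) fun i _ j _ hij => hWind.indepFun hij]
    exact (Finset.sum_le_sum hWvar).trans (by simp)
  have hmean : ∫ ω, (∑ i ∈ s, W i) ω ∂P ≤ s.card * D := by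
    simp only [Finset.sum_apply]
    rw [integral_finsetSum _ fun i _ => (hWLp i).integrable one_le_two]
    exact (Finset.sum_le_sum hWmean).trans (by simp)
  have hc : 0 < s.card * η := by positivity
  have hcheb := ENNReal.toReal_le_of_le_ofReal
    (div_nonneg (variance_nonneg _ _) (sq_nonneg (s.card * η))) (meas_ge_le_variance_div_sq hsumLp hc)
  calc P.real {ω | s.card * (D + η) ≤ ∑ i ∈ s, W i ω}
      ≤ P.real {ω | s.card * η ≤ |(∑ i ∈ s, W i) ω - ∫ ω, (∑ i ∈ s, W i) ω ∂P|} := by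
        refine measureReal_mono fun ω hω => ?_
        simp only [Set.mem_ofPred_eq] at hω ⊢
        refine le_trans ?_ (le_abs_self _)
        rw [Finset.sum_apply]
        linarith
    _ ≤ variance (∑ i ∈ s, W i) P / (s.card * η) ^ 2 := hcheb
    _ ≤ s.card * V / (s.card * η) ^ 2 := by gcongr
    _ = V / (s.card * η ^ 2) := by field_simp

end Sampling

/-! ### Admissible levels and the limit in the number of alternatives -/

theorem le_liminf_of_sub_le {L : ℝ} {u v : ℕ → ℝ} (hv : Tendsto v atTop (𝓝 0))
    (h1 : ∀ k, u k ≤ 1) (h : ∀ᶠ k in atTop, L - v k ≤ u k) : L ≤ liminf u atTop := by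
  have ht : Tendsto (fun k => L - v k) atTop (𝓝 L) := by simpa using hv.const_sub L
  rw [← ht.liminf_eq]
  refine liminf_le_liminf h ht.isBoundedUnder_ge ?_
  exact (isBoundedUnder_of ⟨1, h1⟩).isCoboundedUnder_ge

theorem continuousAt_momentC {q M b : ℝ} (hq : 0 < q) (hM : 0 < M) (hb : 0 < b) (N : ℕ) :
    ContinuousAt (fun b => momentC q M b N) b := by
  have hc := momentC₂_pos hq hM
  have hne : 1 - Real.exp (-(momentC₂ q M * b ^ 2)) ≠ 0 := by
    have : Real.exp (-(momentC₂ q M * b ^ 2)) < 1 := Real.exp_lt_one_iff.2 (by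
      have : 0 < momentC₂ q M * b ^ 2 := by positivity
      linarith)
    linarith
  unfold momentC
  refine ContinuousAt.add (ContinuousAt.add ?_ ?_) continuousAt_const
  · exact (continuousAt_const.mul (Real.continuousAt_rpow_const b (-q) (Or.inl hb.ne'))).mul
      continuousAt_const
  · exact ContinuousAt.div (by fun_prop) (by fun_prop) hne

/-- With the threshold frozen to the left of `γ / 2`, `C` is continuous in `b`, so the strict
inequality at `γ / 2` persists for some `b < γ / 2`; then `g = γ - 2 b`. -/
theorem admissibleSet_nonempty {q M γ c : ℝ} {nf : ℝ → ℕ} (hq : 0 < q) (hM : 0 < M) (hγ : 0 < γ)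
    (hnf_left : ∀ᶠ b in 𝓝[<] (γ / 2), nf b = nf (γ / 2))
    (hc : 2 * momentC q M (γ / 2) (nf (γ / 2)) < c) : (admissibleSet q M γ c nf).Nonempty := by
  have hcont := ((continuousAt_momentC hq hM (half_pos hγ) (nf (γ / 2))).const_mul 2).eventually
    (gt_mem_nhds hc)
  have hpos := (lt_mem_nhds (half_pos hγ) : ∀ᶠ b in 𝓝 (γ / 2), 0 < b)
  obtain ⟨b, ⟨⟨hb1, hb2⟩, hb3⟩, hb4⟩ := (((hcont.and hpos).filter_mono nhdsWithin_le_nhds).and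
    hnf_left |>.and self_mem_nhdsWithin).exists
  have hb4' : b < γ / 2 := hb4
  refine ⟨γ - 2 * b, ⟨by linarith, by linarith⟩, ?_⟩
  rw [show (γ - (γ - 2 * b)) / 2 = b by ring, hb3]
  exact hb1.le

section Selection
variable {Ω : Type*} [MeasurableSpace Ω] {P : Measure Ω} [IsProbabilityMeasure P]
  {ν : (k : ℕ) → Fin (k + 1) → Measure ℝ} {X : (k : ℕ) → Fin (k + 1) → ℕ → Ω → ℝ}

/-- The lower bound on the limiting probability of correct selection at an admissible `g`. -/
theorem measureReal_le_liminf_of_mem_admissibleSet (hX : ∀ k, IsSampling P (ν k) (X k))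
    {ν₁ : Measure ℝ} (hν₁ : ∀ k, ν k 0 = ν₁) {f : ℕ → ℝ} {q M : ℝ} (hq : 3 < q) (hM : 0 < M)
    (hmoment : ∀ k i, Integrable (fun x : ℝ => |x| ^ q) (ν k i) ∧ ∫ x, |x| ^ q ∂(ν k i) ≤ M)
    {γ : ℝ} (hgap : ∀ k (i : Fin (k + 1)), i ≠ 0 → γ ≤ (∫ x, x ∂(ν k 0)) - ∫ x, x ∂(ν k i))
    {nf : ℝ → ℕ} (hnf : ∀ b, 0 < b → IsThreshold f b (nf b)) {c : ℝ} {B : ℕ → ℕ}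
    (hB : ∀ k, |(B k : ℝ) - c * (k + 1)| < 1) {out : (k : ℕ) → Ω → Fin (k + 1)}
    (hout : ∀ k, ∀ᵐ ω ∂P, MetaUCBOutputs f (fun i j => X k i j ω) (B k) (out k ω))
    {g : ℝ} (hg : g ∈ admissibleSet q M γ c nf) :
    (seqLaw ν₁).real {x | (((∫ y, y ∂ν₁) - g : ℝ) : EReal) ≤ ucbInf f x}
      ≤ liminf (fun k => P.real {ω | out k ω = 0}) atTop := by
  obtain ⟨⟨hg0, hgγ⟩, hgc⟩ := hg
  set b := (γ - g) / 2 with hb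
  have hb0 : 0 < b := by rw [hb]; linarith
  set N := nf b with hN
  have hthr : IsThreshold f b N := hnf b hb0
  set D := sizeBound q M b N with hD
  have hDc : D < c / 2 := by linarith [sizeBound_lt_momentC hq.le hM hb0 hthr.1]
  -- This gives `c > 2`, so `c * (k + 1) - 1 > c * k`: the budget of the best alternative absorbs
  -- the rounding.
  have hD1 : 1 ≤ D := by
    have h1 := sum_Ico_tailBound_le hq.le hM hb0 hthr.1 N
    have h2 : (1 : ℝ) ≤ N := by exact_mod_cast hthr.1
    simp only [Finset.Ico_self, Finset.sum_empty, add_zero] at h1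
    linarith
  set V := sizeSqBound q M b N with hV
  set η := (c / 2 - D) / 2 with hη
  have hη0 : 0 < η := by rw [hη]; linarith
  set a := (∫ y, y ∂ν₁) - g with ha
  have hv : Tendsto (fun k : ℕ => V / (k * η ^ 2)) atTop (𝓝 0) :=
    (tendsto_natCast_atTop_atTop.atTop_mul_const (by positivity)).const_div_atTop V
  refine le_liminf_of_sub_le hv (fun k => measureReal_le_one) ?_
  filter_upwards [eventually_ge_atTop 1] with k hk
  have := (hX k).isProbabilityMeasure
  have hk0 : (1 : ℝ) ≤ k := by exact_mod_cast hk
  set s : Finset (Fin (k + 1)) := Finset.univ.erase 0 with hs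
  have hcard : s.card = k := by simp [hs]
  have hmean : ∀ i ∈ s, (∫ x, x ∂(ν k i)) + 2 * b ≤ a := by
    intro i hi
    have h1 := hgap k i (Finset.ne_of_mem_erase hi)
    rw [hν₁ k] at h1
    rw [ha, hb]; linarith
  have hcheb := (hX k).measureReal_sum_runLength_ge_le (f := f) (a := a) (B := B k) (s := s)
    (Finset.card_pos.1 (by omega)) hη0
    (fun i hi => integral_runLength_le hq.le hM (hmoment k i).1 (hmoment k i).2 hb0 hthr
      (hmean i hi) (B k))
    (fun i hi => integral_runLength_sq_le hq hM (hmoment k i).1 (hmoment k i).2 hb0 hthr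
      (hmean i hi) (B k))
  rw [hcard] at hcheb
  have hlaw := (hX k).measureReal_le_ucbInf 0 f a
  rw [hν₁ k] at hlaw
  rw [← hlaw]
  have hsub : ({ω | (a : EReal) ≤ ucbInf f (fun j => X k 0 j ω)} : Set Ω) ≤ᵐ[P]
      ({ω | out k ω = 0}
        ∪ {ω | k * (D + η) ≤ ∑ i ∈ s, runLength f a (B k) (fun j => X k i j ω)} : Set Ω) := by
    filter_upwards [hout k] with ω hω h1
    by_cases h2 : k * (D + η) ≤ ∑ i ∈ s, runLength f a (B k) (fun j => X k i j ω)
    · exact Or.inr h2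
    · refine Or.inl (hω.eq_of_sum_runLength_lt (coe_le_ucbInf_iff.1 h1) ?_)
      have h3 := (abs_lt.1 (hB k)).1
      have h4 : (k : ℝ) * (D + η) ≤ k * (c / 2) := by
        gcongr; rw [hη]; linarith
      push Not at h2
      linarith
  have h1 : P.real {ω | (a : EReal) ≤ ucbInf f (fun j => X k 0 j ω)}
      ≤ P.real ({ω | out k ω = 0}
        ∪ {ω | k * (D + η) ≤ ∑ i ∈ s, runLength f a (B k) (fun j => X k i j ω)}) :=
    ENNReal.toReal_mono (measure_ne_top _ _) (measure_mono_ae hsub)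
  -- Monotonicity and subadditivity hold for arbitrary sets, so the tie-breaking need not be
  -- measurable.
  have h2 := measureReal_union_le (μ := P) {ω | out k ω = 0}
    {ω | k * (D + η) ≤ ∑ i ∈ s, runLength f a (B k) (fun j => X k i j ω)}
  linarith

end Selection

/-- The problem with index `k` has `k + 1` alternatives, and alternative `0` is the best one. -/
theorem theorem2 {Ω : Type*} [MeasurableSpace Ω] (P : Measure Ω) [IsProbabilityMeasure P]
    -- the distributions of the alternatives and their observations, for every problem size
    (ν : (k : ℕ) → Fin (k + 1) → Measure ℝ)
    (X : (k : ℕ) → Fin (k + 1) → ℕ → Ω → ℝ)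
    (hX : ∀ k, IsSampling P (ν k) (X k))
    -- the distribution of the best alternative does not change with the problem size
    (ν₁ : Measure ℝ) (hν₁ : ∀ k, ν k 0 = ν₁)
    -- the bonus function
    (f : ℕ → ℝ) (hf : IsBonus f)
    -- continuous distributions with bounded absolute moments of order `q > 3`
    (q M : ℝ) (hq : 3 < q) (hM : 0 < M)
    (hcont : ∀ k i (x : ℝ), ν k i {x} = 0)
    (hmoment : ∀ k i, Integrable (fun x : ℝ => |x| ^ q) (ν k i) ∧ ∫ x, |x| ^ q ∂(ν k i) ≤ M)
    -- indifference zone and variance bounds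
    (γ σlo σhi : ℝ) (hγ : 0 < γ) (hσlo : 0 < σlo) (hσhi : 0 < σhi)
    (hgap : ∀ k (i : Fin (k + 1)), i ≠ 0 → γ ≤ (∫ x, x ∂(ν k 0)) - ∫ x, x ∂(ν k i))
    (hvar : ∀ k i, σlo ^ 2 ≤ variance id (ν k i) ∧ variance id (ν k i) ≤ σhi ^ 2)
    -- a choice of the thresholds `n^f(b)`, locally constant to the left of `γ / 2`
    -- (the least thresholds have this property)
    (nf : ℝ → ℕ) (hnf : ∀ b, 0 < b → IsThreshold f b (nf b))
    (hnf_left : ∀ᶠ b in 𝓝[<] (γ / 2), nf b = nf (γ / 2))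
    -- the total budget is `c` times the number of alternatives, rounded up or down
    (c : ℝ) (hc : 2 * momentC q M (γ / 2) (nf (γ / 2)) < c)
    (B : ℕ → ℕ) (hB : ∀ k, |(B k : ℝ) - c * (k + 1)| < 1)
    -- the output of the meta-UCB algorithm, with any tie-breaking
    (out : (k : ℕ) → Ω → Fin (k + 1))
    (hout : ∀ k, ∀ᵐ ω ∂P, MetaUCBOutputs f (fun i j => X k i j ω) (B k) (out k ω)) :
    ∃ γ₀ : ℝ, IsLUB (admissibleSet q M γ c nf) γ₀ ∧
      -- the law of `U_1^*` is the same in all the problems, so any index `m` may be used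
      (∀ m, P.real {ω | (((∫ x, x ∂ν₁) - γ₀ : ℝ) : EReal) ≤ ucbInf f (fun j => X m 0 j ω)}
          ≤ liminf (fun k => P.real {ω | out k ω = 0}) atTop) ∧
      (∀ m, 0 < P.real {ω | (((∫ x, x ∂ν₁) - γ₀ : ℝ) : EReal)
          ≤ ucbInf f (fun j => X m 0 j ω)}) ∧
      -- sample optimality
      (∃ α ∈ Set.Ioo (0 : ℝ) 1,
        α < liminf (fun k => P.real {ω | out k ω = 0}) atTop) := by
  have hprob : IsProbabilityMeasure ν₁ := hν₁ 0 ▸ (hX 0).isProbabilityMeasure 0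
  have hint : Integrable (fun x : ℝ => x) ν₁ :=
    integrable_id_of_rpow hq.le (hν₁ 0 ▸ (hmoment 0 0).1)
  have hne := admissibleSet_nonempty (by linarith) hM hγ hnf_left hc
  have hlub : IsLUB (admissibleSet q M γ c nf) (sSup (admissibleSet q M γ c nf)) :=
    isLUB_csSup hne ⟨γ, fun g hg => hg.1.2.le⟩
  set γ₀ := sSup (admissibleSet q M γ c nf)
  have hγ₀ : 0 < γ₀ := by
    obtain ⟨g, hg⟩ := hne
    exact hg.1.1.trans_le (hlub.1 hg)
  have hlaw : ∀ m, P.real {ω | (((∫ x, x ∂ν₁) - γ₀ : ℝ) : EReal) ≤ ucbInf f (fun j => X m 0 j ω)}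
      = (seqLaw ν₁).real {x | (((∫ x, x ∂ν₁) - γ₀ : ℝ) : EReal) ≤ ucbInf f x} := fun m =>
    hν₁ m ▸ (hX m).measureReal_le_ucbInf 0 f _
  have hpos := measureReal_le_ucbInf_pos hf hint hγ₀
  obtain ⟨g, hgmono, -, hglim, hgmem⟩ := hlub.exists_seq_monotone_tendsto hne
  have hle := measureReal_le_ucbInf_le_of_tendsto hf hint (hν₁ 0 ▸ hcont 0 0) hγ₀ hgmono hglim
    fun j => measureReal_le_liminf_of_mem_admissibleSet hX hν₁ hq hM hmoment hgap hnf hB hout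
      (hgmem j)
  refine ⟨γ₀, hlub, fun m => (hlaw m).trans_le hle, fun m => (hlaw m).symm ▸ hpos, ?_⟩
  have hle1 : (seqLaw ν₁).real {x | (((∫ x, x ∂ν₁) - γ₀ : ℝ) : EReal) ≤ ucbInf f x} ≤ 1 :=
    measureReal_le_one
  exact ⟨_, ⟨half_pos hpos, by linarith⟩, (half_lt_self hpos).trans_le hle⟩
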